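/- Let $n \ge 2$ and let $w_0 = n(n-1)\cdots 21$ be the longest element of $\mathfrak{S}_n$. Elnitsky's polygon $X(w_0)$ is the convex, centrally symmetric, equilateral $2n$-gon whose sides, starting at the topmost vertex and read counterclockwise, are labeled $1,\ldots,n,1,\ldots,n$, where sides are parallel exactly when they have the same label; the first $n$ of these sides form the leftside boundary and the other $n$ form the rightside boundary (each running from the topmost to the bottommost vertex). Let $T(w_0)$ be the set of its rhombic tilings, i.e., edge-to-edge tilings of $X(w_0)$ by rhombi all of whose edges are congruent and parallel to sides of $X(w_0)$. A tile is a perimeter tile if it shares a path of at least two edges with the boundary of $X(w_0)$, and it is a side-perimeter tile if, moreover, it contains two edges of the leftside boundary or two edges of the rightside boundary. Let $\mathsf{perim}(T)$ be the number of perimeter tiles of $T$. Then $$\max\{\mathsf{perim}(T) : T \in T(w_0)\} = 2\left\lfloor \frac{n-1}{2}\right\rfloor + 1 = \begin{cases} n & \text{if } n \text{ is odd},\\ n-1 & \text{if } n \text{ is even},\end{cases}$$ and every $T \in T(w_0)$ has at most $n-1$ side-perimeter tiles. -/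

import Mathlib

/-! Rhombic tilings of Elnitsky's polygon of the longest permutation `w₀ = n (n-1) ⋯ 2 1`.
The plane is `ℂ`, labels `1, …, n` are the elements `0, …, n-1` of `Fin n`, and the topmost vertex
of the polygon is placed at the origin. -/

namespace Elnitsky

/-- `θ` lists the directions of the sides `1, …, n` of the leftside boundary, traversed
counterclockwise from the topmost vertex: every side goes strictly downwards, and the path turns
strictly to the left at each vertex, so these sides form half of a convex `2n`-gon. -/
structure IsAdmissible {n : ℕ} (θ : Fin n → ℝ) : Prop where
  strictMono : StrictMono θ
  downward : ∀ i, θ i ∈ Set.Ioo Real.pi (2 * Real.pi)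

/-- The unit vector along the side with label `i`. -/
noncomputable def dir {n : ℕ} (θ : Fin n → ℝ) (i : Fin n) : ℂ :=
  Complex.exp ((θ i : ℂ) * Complex.I)

/-- The longest permutation, `w₀(i) = n + 1 - i` in 1-based notation. -/
def longest (n : ℕ) : Equiv.Perm (Fin n) := Fin.revPerm

/-- The `k`-th vertex (`0 ≤ k ≤ n`) of the leftside boundary, whose sides are labeled
`1, …, n` from top to bottom. -/
noncomputable def leftVertex {n : ℕ} (θ : Fin n → ℝ) (k : ℕ) : ℂ :=
  ∑ i : Fin n with i.val < k, dir θ i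

/-- The `k`-th vertex (`0 ≤ k ≤ n`) of the rightside boundary, whose sides are labeled
`w₀(1), …, w₀(n)` from top to bottom. -/
noncomputable def rightVertex {n : ℕ} (θ : Fin n → ℝ) (k : ℕ) : ℂ :=
  ∑ i : Fin n with i.val < k, dir θ (longest n i)

/-- The sides of the leftside boundary. -/
def leftSides {n : ℕ} (θ : Fin n → ℝ) : Set (Set ℂ) :=
  {e | ∃ k < n, e = segment ℝ (leftVertex θ k) (leftVertex θ (k + 1))}

/-- The sides of the rightside boundary. -/
def rightSides {n : ℕ} (θ : Fin n → ℝ) : Set (Set ℂ) :=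
  {e | ∃ k < n, e = segment ℝ (rightVertex θ k) (rightVertex θ (k + 1))}

/-- The `2n` sides of the polygon. -/
def sides {n : ℕ} (θ : Fin n → ℝ) : Set (Set ℂ) :=
  leftSides θ ∪ rightSides θ

/-- The closed region `X(w₀)`. For the longest permutation the polygon is convex, so the region is
the convex hull of the vertices. -/
def polygon {n : ℕ} (θ : Fin n → ℝ) : Set ℂ :=
  convexHull ℝ {z | ∃ k ≤ n, z = leftVertex θ k ∨ z = rightVertex θ k}

/-- A rhombus whose edges are unit segments parallel to the sides labeled `i < j`, given by its
topmost vertex and its edge labels. -/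
structure Tile (n : ℕ) where
  top : ℂ
  i : Fin n
  j : Fin n
  lt : i < j

namespace Tile

variable {n : ℕ}

/-- The closed rhombus occupied by a tile. -/
def carrier (θ : Fin n → ℝ) (t : Tile n) : Set ℂ :=
  {z | ∃ a ∈ Set.Icc (0 : ℝ) 1, ∃ b ∈ Set.Icc (0 : ℝ) 1,
    z = t.top + (a : ℂ) * dir θ t.i + (b : ℂ) * dir θ t.j}

/-- The four vertices of a tile, in cyclic (counterclockwise) order. -/
noncomputable def vertex (θ : Fin n → ℝ) (t : Tile n) : Fin 4 → ℂ :=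
  ![t.top, t.top + dir θ t.i, t.top + dir θ t.i + dir θ t.j, t.top + dir θ t.j]

/-- The four edges of a tile, in cyclic order; `k + 1` is taken modulo `4`. -/
def edge (θ : Fin n → ℝ) (t : Tile n) (k : Fin 4) : Set ℂ :=
  segment ℝ (t.vertex θ k) (t.vertex θ (k + 1))

/-- A (strong) perimeter tile: it shares a path of at least two edges with the boundary, that is,
two consecutive edges of the tile are sides of the polygon. -/
def IsPerimeter (θ : Fin n → ℝ) (t : Tile n) : Prop :=
  ∃ k : Fin 4, t.edge θ k ∈ sides θ ∧ t.edge θ (k + 1) ∈ sides θ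

/-- A left-perimeter tile: a perimeter tile that includes two edges from the leftside boundary. -/
def IsLeftPerimeter (θ : Fin n → ℝ) (t : Tile n) : Prop :=
  t.IsPerimeter θ ∧ ∃ k l : Fin 4, k ≠ l ∧ t.edge θ k ∈ leftSides θ ∧ t.edge θ l ∈ leftSides θ

/-- A right-perimeter tile: a perimeter tile that includes two edges from the rightside
boundary. -/
def IsRightPerimeter (θ : Fin n → ℝ) (t : Tile n) : Prop :=
  t.IsPerimeter θ ∧ ∃ k l : Fin 4, k ≠ l ∧ t.edge θ k ∈ rightSides θ ∧ t.edge θ l ∈ rightSides θ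

/-- A side-perimeter tile: a left-perimeter or a right-perimeter tile. -/
def IsSidePerimeter (θ : Fin n → ℝ) (t : Tile n) : Prop :=
  t.IsLeftPerimeter θ ∨ t.IsRightPerimeter θ

end Tile

/-- A rhombic tiling of `X(w₀)`: the tiles cover exactly the region, have pairwise disjoint
interiors, and fit together edge to edge (two tile edges that meet in more than one point
coincide). -/
structure IsRhombicTiling {n : ℕ} (θ : Fin n → ℝ) (T : Finset (Tile n)) : Prop where
  cover : (⋃ t ∈ T, t.carrier θ) = polygon θ
  disjoint_interior : ∀ s ∈ T, ∀ t ∈ T, s ≠ t →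
    Disjoint (interior (s.carrier θ)) (interior (t.carrier θ))
  edge_to_edge : ∀ s ∈ T, ∀ t ∈ T, ∀ k l : Fin 4,
    (s.edge θ k ∩ t.edge θ l).Nontrivial → s.edge θ k = t.edge θ l

open Classical in
/-- The number of perimeter tiles of a tiling. -/
noncomputable def perim {n : ℕ} (θ : Fin n → ℝ) (T : Finset (Tile n)) : ℕ :=
  (T.filter fun t => t.IsPerimeter θ).card

open Classical in
/-- The number of side-perimeter tiles of a tiling. -/
noncomputable def sidePerim {n : ℕ} (θ : Fin n → ℝ) (T : Finset (Tile n)) : ℕ :=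
  (T.filter fun t => t.IsSidePerimeter θ).card

end Elnitsky

/-! A permutation `σ` of the labels gives a path descending from the topmost to the bottommost
vertex: label `x` is traversed at position `σ x`. The leftside boundary is the identity, the
rightside boundary the reversal. If `i < j` are consecutive on a path, exchanging them pushes the
path to the right across one rhombus with labels `i, j`. Both halves of the proof rest on this flip.

Upper bounds. In any tiling, sweep a path from the leftside boundary to the right. Among the tiles
not yet passed there is a leftmost one; it must rest on two consecutive edges of the path, and
passing it is a flip. By induction every remaining tile has its labels in path order, so a pair of
labels never returns once flipped (`sweep`, `tile_eq_of_labels`). A side-perimeter tile has adjacent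
labels `k, k+1`, which leaves `n - 1` possibilities (`sidePerim_le`). Any other perimeter tile sits
at the topmost or bottommost vertex and has the labels `0, n-1` (`perimeter_cases`), so there are at
most `n` perimeter tiles.

For even `n` the value `n` is impossible (`not_all_pairs`). Tiles with labels `k, k+1` and `k+1,
k+2` cannot lie on the same side of the polygon, since both would use its side labeled `k+1`. If all
adjacent pairs occur they alternate between left and right, and as `n - 1` is odd the first and the
last are on the same side. A tile with labels `0, n-1` at the top or bottom needs one of the sides
that these two occupy.

Sharpness. Conversely, flips starting from the leftside boundary and ending at the rightside
boundary build a tiling (`Built.step`, `Built.isRhombicTiling`). Sorting the path in stages by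
suitable keys (`Built.extend`) controls where each rhombus lands: the pairs `2k+1, 2k+2` are flipped
first, on the left; for odd `n` the label `n-1` is then moved to the front, which fills the top
corner; the pairs `2k, 2k+1` are flipped last, on the right (`exists_tiling`). -/

namespace Elnitsky

/-! ### Determinants and sums of side directions -/

/-- The determinant of two plane vectors. -/
def cross (u v : ℂ) : ℝ := u.re * v.im - u.im * v.re

theorem cross_add_right (u v w : ℂ) : cross u (v + w) = cross u v + cross u w := by
  simp [cross]; ring

theorem cross_sub_right (u v w : ℂ) : cross u (v - w) = cross u v - cross u w := by
  simp [cross]; ring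

theorem cross_neg_right (u v : ℂ) : cross u (-v) = -cross u v := by
  simp [cross]; ring

theorem cross_mul_right (u v : ℂ) (a : ℝ) : cross u (a * v) = a * cross u v := by
  simp [cross]; ring

theorem cross_self (u : ℂ) : cross u u = 0 := by
  simp [cross]; ring

theorem cross_swap (u v : ℂ) : cross u v = -cross v u := by
  simp [cross]; ring

theorem cross_sum_right {ι : Type*} (u : ℂ) (s : Finset ι) (f : ι → ℂ) :
    cross u (∑ x ∈ s, f x) = ∑ x ∈ s, cross u (f x) := by
  simp [cross, Finset.mul_sum, Finset.sum_sub_distrib]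

theorem cross_sum_left {ι : Type*} (v : ℂ) (s : Finset ι) (f : ι → ℂ) :
    cross (∑ x ∈ s, f x) v = ∑ x ∈ s, cross (f x) v := by
  simp [cross, Finset.sum_mul, Finset.sum_sub_distrib]

theorem continuous_cross_right (u : ℂ) : Continuous (cross u) := by
  unfold cross; fun_prop

variable {n : ℕ} {θ : Fin n → ℝ}

theorem cross_dir (θ : Fin n → ℝ) (i j : Fin n) :
    cross (dir θ i) (dir θ j) = Real.sin (θ j - θ i) := by
  simp only [cross, dir, Complex.exp_ofReal_mul_I_re, Complex.exp_ofReal_mul_I_im, Real.sin_sub]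
  ring

theorem IsAdmissible.im_dir_neg (hθ : IsAdmissible θ) (i : Fin n) : (dir θ i).im < 0 := by
  have h := hθ.downward i
  rw [dir, Complex.exp_ofReal_mul_I_im, ← Real.sin_sub_two_pi]
  exact Real.sin_neg_of_neg_of_neg_pi_lt (by linarith [h.2]) (by linarith [h.1])

theorem IsAdmissible.cross_pos (hθ : IsAdmissible θ) {i j : Fin n} (h : i < j) :
    0 < cross (dir θ i) (dir θ j) := by
  rw [cross_dir]
  have h1 := hθ.downward i
  have h2 := hθ.downward j
  have h3 := hθ.strictMono h
  exact Real.sin_pos_of_pos_of_lt_pi (by linarith) (by linarith [h1.1, h2.2])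

theorem IsAdmissible.cross_neg (hθ : IsAdmissible θ) {i j : Fin n} (h : j < i) :
    cross (dir θ i) (dir θ j) < 0 := by
  rw [cross_swap]; linarith [hθ.cross_pos h]

theorem IsAdmissible.eq_of_cross_eq_zero (hθ : IsAdmissible θ) {i j : Fin n}
    (h : cross (dir θ i) (dir θ j) = 0) : i = j := by
  rcases lt_trichotomy i j with h1 | h1 | h1
  · exact absurd h (hθ.cross_pos h1).ne'
  · exact h1
  · exact absurd h (hθ.cross_neg h1).ne

theorem IsAdmissible.im_sum_nonpos (hθ : IsAdmissible θ) (A : Finset (Fin n)) :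
    (∑ x ∈ A, dir θ x).im ≤ 0 := by
  rw [Complex.im_sum]
  exact Finset.sum_nonpos fun x _ => (hθ.im_dir_neg x).le

theorem IsAdmissible.eq_empty_of_im_sum (hθ : IsAdmissible θ) (A : Finset (Fin n))
    (h : 0 ≤ (∑ x ∈ A, dir θ x).im) : A = ∅ := by
  by_contra hA
  rw [Complex.im_sum] at h
  exact absurd h (not_le.2 (Finset.sum_neg (fun x _ => hθ.im_dir_neg x)
    (Finset.nonempty_iff_ne_empty.2 hA)))

/-- Sums of sides over two sets, one of whose differences precedes the other, determine the sets. -/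
theorem IsAdmissible.eq_of_sum_eq (hθ : IsAdmissible θ) {A B : Finset (Fin n)}
    (hAB : ∀ x ∈ A \ B, ∀ y ∈ B \ A, x < y)
    (h : ∑ x ∈ A, dir θ x = ∑ x ∈ B, dir θ x) : A = B := by
  have h1 : ∑ x ∈ A \ B, dir θ x = ∑ x ∈ B \ A, dir θ x := by
    have e1 := Finset.sum_inter_add_sum_sdiff A B (dir θ)
    have e2 := Finset.sum_inter_add_sum_sdiff B A (dir θ)
    rw [Finset.inter_comm] at e2
    have : ∑ x ∈ A ∩ B, dir θ x + ∑ x ∈ A \ B, dir θ x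
        = ∑ x ∈ A ∩ B, dir θ x + ∑ x ∈ B \ A, dir θ x := by rw [e1, e2, h]
    exact add_left_cancel this
  -- If both differences were nonempty, the determinant of their sums would be positive term by
  -- term, yet the two sums are equal. Once one difference is empty, the other has a sum of height
  -- zero and is empty too.
  have key : A \ B = ∅ ∨ B \ A = ∅ := by
    by_contra hne
    push Not at hne
    have h2 : 0 < cross (∑ x ∈ A \ B, dir θ x) (∑ x ∈ B \ A, dir θ x) := by
      rw [cross_sum_left]
      refine Finset.sum_pos (fun x hx => ?_) hne.1
      rw [cross_sum_right]
      exact Finset.sum_pos (fun y hy => hθ.cross_pos (hAB x hx y hy)) hne.2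
    rw [h1, cross_self] at h2
    exact lt_irrefl _ h2
  have both : A \ B = ∅ ∧ B \ A = ∅ := by
    rcases key with k | k
    · refine ⟨k, hθ.eq_empty_of_im_sum _ ?_⟩
      rw [← h1, k]; simp
    · refine ⟨hθ.eq_empty_of_im_sum _ ?_, k⟩
      rw [h1, k]; simp
  exact Finset.Subset.antisymm (Finset.sdiff_eq_empty_iff_subset.1 both.1)
    (Finset.sdiff_eq_empty_iff_subset.1 both.2)

/-! ### Descending paths given by permutations of the labels -/

/-- The upper endpoint of the edge labeled `m` on the downward path from the top vertex in which
the label `x` occupies position `σ x`. -/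
noncomputable def start (θ : Fin n → ℝ) (σ : Equiv.Perm (Fin n)) (m : Fin n) : ℂ :=
  ∑ x with σ x < σ m, dir θ x

theorem leftVertex_eq_start (θ : Fin n → ℝ) (m : Fin n) : leftVertex θ m = start θ 1 m := rfl

theorem rightVertex_eq_start (θ : Fin n → ℝ) (m : Fin n) :
    rightVertex θ (m.rev : ℕ) = start θ Fin.revPerm m := by
  unfold rightVertex start
  refine Finset.sum_equiv Fin.revPerm (fun x => ?_) (fun x _ => rfl)
  simp only [Finset.mem_filter, Finset.mem_univ, true_and, Fin.revPerm_apply, Fin.rev_rev,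
    Fin.lt_def]

theorem start_add_dir (θ : Fin n → ℝ) (σ : Equiv.Perm (Fin n)) (m : Fin n) :
    start θ σ m + dir θ m = ∑ x with σ x ≤ σ m, dir θ x := by
  have : (Finset.univ.filter fun x => σ x ≤ σ m)
      = insert m (Finset.univ.filter fun x => σ x < σ m) := by
    ext x
    simp only [Finset.mem_filter, Finset.mem_univ, true_and, Finset.mem_insert, le_iff_lt_or_eq,
      σ.injective.eq_iff]
    tauto
  rw [this, Finset.sum_insert (by simp), start, add_comm]

theorem leftVertex_succ (θ : Fin n → ℝ) (m : Fin n) :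
    leftVertex θ (m + 1) = start θ 1 m + dir θ m := by
  rw [start_add_dir, leftVertex]
  refine Finset.sum_congr (Finset.filter_congr fun x _ => ?_) fun _ _ => rfl
  rw [Equiv.Perm.one_apply, Equiv.Perm.one_apply, Fin.le_def, Nat.lt_succ_iff]

theorem rightVertex_succ (θ : Fin n → ℝ) (m : Fin n) :
    rightVertex θ ((m.rev : ℕ) + 1) = start θ Fin.revPerm m + dir θ m := by
  rw [start_add_dir, rightVertex]
  refine Finset.sum_equiv Fin.revPerm (fun x => ?_) (fun x _ => rfl)
  rw [Finset.mem_filter, Finset.mem_filter]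
  simp only [Finset.mem_univ, true_and, Fin.revPerm_apply, Fin.rev_rev, Fin.le_def,
    Nat.lt_succ_iff]

theorem mem_leftSides_iff (θ : Fin n → ℝ) (e : Set ℂ) :
    e ∈ leftSides θ ↔ ∃ m, e = segment ℝ (start θ 1 m) (start θ 1 m + dir θ m) := by
  constructor
  · rintro ⟨k, hk, rfl⟩
    exact ⟨⟨k, hk⟩, by rw [← leftVertex_succ, ← leftVertex_eq_start]⟩
  · rintro ⟨m, rfl⟩
    exact ⟨m, m.2, by rw [← leftVertex_succ, ← leftVertex_eq_start]⟩

theorem mem_rightSides_iff (θ : Fin n → ℝ) (e : Set ℂ) :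
    e ∈ rightSides θ ↔
      ∃ m, e = segment ℝ (start θ Fin.revPerm m) (start θ Fin.revPerm m + dir θ m) := by
  constructor
  · rintro ⟨k, hk, rfl⟩
    refine ⟨Fin.rev ⟨k, hk⟩, ?_⟩
    rw [← rightVertex_succ, ← rightVertex_eq_start, Fin.rev_rev]
  · rintro ⟨m, rfl⟩
    exact ⟨m.rev, m.rev.2, by rw [← rightVertex_succ, ← rightVertex_eq_start]⟩

/-- The two points differ by the directions of the labels strictly between `m` and `m'` on the path.
That sum goes strictly down unless there are no such labels. -/
theorem IsAdmissible.start_add_eq_or_lt (hθ : IsAdmissible θ) {σ : Equiv.Perm (Fin n)}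
    {m m' : Fin n} (h : σ m < σ m') :
    start θ σ m + dir θ m = start θ σ m' ∨
      (start θ σ m').im < (start θ σ m + dir θ m).im := by
  rw [start_add_dir]
  unfold start
  have hsub : (Finset.univ.filter fun x => σ x ≤ σ m) ⊆
      (Finset.univ.filter fun x => σ x < σ m') := by
    intro x
    simp only [Finset.mem_filter, Finset.mem_univ, true_and]
    exact fun hx => hx.trans_lt h
  rw [← Finset.sum_sdiff (f := dir θ) hsub]
  by_cases he : (∑ x ∈ (Finset.univ.filter fun x => σ x < σ m') \
      (Finset.univ.filter fun x => σ x ≤ σ m), dir θ x).im < 0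
  · right
    rw [Complex.add_im]; linarith
  · left
    rw [hθ.eq_empty_of_im_sum _ (not_lt.1 he)]; simp

theorem IsAdmissible.im_start_le (hθ : IsAdmissible θ) {σ : Equiv.Perm (Fin n)}
    {m m' : Fin n} (h : σ m < σ m') :
    (start θ σ m').im ≤ (start θ σ m + dir θ m).im := by
  rcases hθ.start_add_eq_or_lt h with h | h
  · rw [h]
  · exact h.le

theorem IsAdmissible.im_start_lt (hθ : IsAdmissible θ) {σ : Equiv.Perm (Fin n)}
    {m m' : Fin n} (h : σ m < σ m') : (start θ σ m').im < (start θ σ m).im := by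
  have := hθ.im_start_le h
  rw [Complex.add_im] at this
  linarith [hθ.im_dir_neg m]

theorem start_next (θ : Fin n → ℝ) {σ : Equiv.Perm (Fin n)} {i j : Fin n}
    (h : (σ j : ℕ) = σ i + 1) : start θ σ j = start θ σ i + dir θ i := by
  rw [start_add_dir, start]
  congr 1
  ext x
  simp only [Finset.mem_filter, Finset.mem_univ, true_and, Fin.lt_def, Fin.le_def]
  omega

theorem IsAdmissible.next_of_start (hθ : IsAdmissible θ) {σ : Equiv.Perm (Fin n)} {i j : Fin n}
    (h : start θ σ j = start θ σ i + dir θ i) : (σ j : ℕ) = σ i + 1 := by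
  have hi := hθ.im_dir_neg i
  have him : (start θ σ j).im = (start θ σ i).im + (dir θ i).im := by rw [h, Complex.add_im]
  rcases lt_trichotomy (σ i) (σ j) with h1 | h1 | h1
  · by_contra hne
    have h2 : (σ i : ℕ) + 1 < σ j := by have := Fin.lt_def.1 h1; omega
    obtain ⟨x, hx⟩ := σ.surjective ⟨σ i + 1, by omega⟩
    have hx' : (σ x : ℕ) = σ i + 1 := by rw [hx]
    have h3 := start_next θ hx'
    have h4 := hθ.im_start_lt (σ := σ) (m := x) (m' := j) (by rw [Fin.lt_def]; omega)
    rw [h3, ← h] at h4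
    exact lt_irrefl _ h4
  · rw [σ.injective h1] at him hi; linarith [hθ.im_dir_neg j]
  · have := hθ.im_start_lt h1; linarith

/-! ### Exchanging two consecutive labels of a path -/

section swap

variable {σ : Equiv.Perm (Fin n)} {i j : Fin n}

/-- As `i` and `j` are consecutive, a third label is preceded by both of them or by neither, so the
set of its predecessors does not change. -/
theorem start_swap_of_ne (θ : Fin n → ℝ) (h : (σ j : ℕ) = σ i + 1) {x : Fin n} (hi : x ≠ i)
    (hj : x ≠ j) : start θ (σ * Equiv.swap i j) x = start θ σ x := by
  have h1 : (σ x : ℕ) ≠ σ i := fun e => hi (σ.injective (Fin.ext e))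
  have h2 : (σ x : ℕ) ≠ σ j := fun e => hj (σ.injective (Fin.ext e))
  unfold start
  congr 1
  ext y
  simp only [Finset.mem_filter, Finset.mem_univ, true_and, Equiv.Perm.mul_apply,
    Equiv.swap_apply_of_ne_of_ne hi hj, Fin.lt_def]
  by_cases hy : y = i
  · subst hy; rw [Equiv.swap_apply_left]; omega
  by_cases hy' : y = j
  · subst hy'; rw [Equiv.swap_apply_right]; omega
  rw [Equiv.swap_apply_of_ne_of_ne hy hy']

theorem start_swap_right (θ : Fin n → ℝ) (h : (σ j : ℕ) = σ i + 1) :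
    start θ (σ * Equiv.swap i j) j = start θ σ i := by
  unfold start
  congr 1
  ext y
  simp only [Finset.mem_filter, Finset.mem_univ, true_and, Equiv.Perm.mul_apply,
    Equiv.swap_apply_right, Fin.lt_def]
  by_cases hy : y = i
  · subst hy; rw [Equiv.swap_apply_left]; omega
  by_cases hy' : y = j
  · subst hy'; rw [Equiv.swap_apply_right]; omega
  rw [Equiv.swap_apply_of_ne_of_ne hy hy']

theorem swap_next (h : (σ j : ℕ) = σ i + 1) :
    (((σ * Equiv.swap i j) i : Fin n) : ℕ) = (σ * Equiv.swap i j) j + 1 := by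
  simpa using h

theorem start_swap_left (θ : Fin n → ℝ) (h : (σ j : ℕ) = σ i + 1) :
    start θ (σ * Equiv.swap i j) i = start θ σ i + dir θ j := by
  rw [start_next θ (swap_next h), start_swap_right θ h]

/-- Exchanging two adjacent positions changes the order of no other pair. -/
theorem swap_lt_iff (h : (σ j : ℕ) = σ i + 1) {x y : Fin n} (h1 : ¬(x = i ∧ y = j))
    (h2 : ¬(x = j ∧ y = i)) :
    (σ * Equiv.swap i j) x < (σ * Equiv.swap i j) y ↔ σ x < σ y := by
  have inj : ∀ a b : Fin n, (σ a : ℕ) = σ b → a = b := fun a b e => σ.injective (Fin.ext e)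
  have e1 := inj x i
  have e2 := inj x j
  have e3 := inj y i
  have e4 := inj y j
  simp only [Equiv.Perm.mul_apply, Fin.lt_def]
  by_cases hx : x = i
  · by_cases hy : y = i
    · rw [hx, hy]; simp
    · have hy' : y ≠ j := fun e => h1 ⟨hx, e⟩
      rw [Equiv.swap_apply_of_ne_of_ne hy hy', hx, Equiv.swap_apply_left]
      have : (σ y : ℕ) ≠ σ j := fun e => hy' (e4 e)
      omega
  by_cases hx' : x = j
  · by_cases hy : y = j
    · rw [hx', hy]; simp
    · have hy' : y ≠ i := fun e => h2 ⟨hx', e⟩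
      rw [Equiv.swap_apply_of_ne_of_ne hy' hy, hx', Equiv.swap_apply_right]
      have : (σ y : ℕ) ≠ σ i := fun e => hy' (e3 e)
      omega
  have hxi : (σ x : ℕ) ≠ σ i := fun e => hx (e1 e)
  have hxj : (σ x : ℕ) ≠ σ j := fun e => hx' (e2 e)
  rw [Equiv.swap_apply_of_ne_of_ne hx hx']
  by_cases hy : y = i
  · subst hy; rw [Equiv.swap_apply_left]; omega
  by_cases hy' : y = j
  · subst hy'; rw [Equiv.swap_apply_right]; omega
  rw [Equiv.swap_apply_of_ne_of_ne hy hy']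

end swap

/-! ### The two sides of a path, and the polygon as a region between paths -/

/-- `z` lies in the horizontal strip of the path edge labeled `m`. -/
def InStrip (θ : Fin n → ℝ) (σ : Equiv.Perm (Fin n)) (m : Fin n) (z : ℂ) : Prop :=
  z.im ≤ (start θ σ m).im ∧ (start θ σ m).im + (dir θ m).im ≤ z.im

/-- `z` lies weakly to the right of the path `σ`. -/
def RightOf (θ : Fin n → ℝ) (σ : Equiv.Perm (Fin n)) (z : ℂ) : Prop :=
  ∀ m, InStrip θ σ m z → 0 ≤ cross (dir θ m) (z - start θ σ m)

/-- `z` lies weakly to the left of the path `σ`. -/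
def LeftOf (θ : Fin n → ℝ) (σ : Equiv.Perm (Fin n)) (z : ℂ) : Prop :=
  ∀ m, InStrip θ σ m z → cross (dir θ m) (z - start θ σ m) ≤ 0

theorem exists_inStrip (hn : 0 < n) (σ : Equiv.Perm (Fin n)) {z : ℂ} (h0 : z.im ≤ 0)
    (h1 : (∑ x, dir θ x).im ≤ z.im) : ∃ m, InStrip θ σ m z := by
  let S := Finset.univ.filter fun m => z.im ≤ (start θ σ m).im
  have hS : S.Nonempty := by
    refine ⟨σ.symm ⟨0, hn⟩, ?_⟩
    simp only [S, Finset.mem_filter, Finset.mem_univ, true_and, start, Equiv.apply_symm_apply,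
      Fin.lt_def]
    simpa using h0
  obtain ⟨m, hm, hmax⟩ := S.exists_max_image σ hS
  refine ⟨m, (Finset.mem_filter.1 hm).2, ?_⟩
  by_cases hlast : (σ m : ℕ) + 1 < n
  · have hx' : (σ (σ.symm ⟨σ m + 1, hlast⟩) : ℕ) = σ m + 1 := by simp
    set x := σ.symm ⟨σ m + 1, hlast⟩
    have hxS : x ∉ S := fun hx => by
      have := Fin.le_def.1 (hmax x hx); omega
    have : (start θ σ x).im < z.im := by simpa [S] using hxS
    rw [start_next θ hx', Complex.add_im] at this
    exact this.le
  · rw [← Complex.add_im, start_add_dir, Finset.filter_true_of_mem]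
    · exact h1
    · intro x _; rw [Fin.le_def]; omega

theorem cross_of_im_eq {u z w : ℂ} (h : z.im = w.im) :
    cross u (z - w) = -u.im * (z.re - w.re) := by
  simp [cross, h]

/-- The point at the height of `z` on the path edge labeled `m`. -/
theorem IsAdmissible.exists_on_edge (hθ : IsAdmissible θ) {σ : Equiv.Perm (Fin n)} {m : Fin n}
    {z : ℂ} (h : InStrip θ σ m z) : ∃ s ∈ Set.Icc (0 : ℝ) 1,
      (start θ σ m + s * dir θ m).im = z.im ∧
      cross (dir θ m) (z - start θ σ m) =
        -(dir θ m).im * (z.re - (start θ σ m + s * dir θ m).re) := by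
  have hd := hθ.im_dir_neg m
  have him : (start θ σ m + ((z.im - (start θ σ m).im) / (dir θ m).im : ℝ) * dir θ m).im = z.im := by
    rw [Complex.add_im, Complex.im_ofReal_mul, div_mul_cancel₀ _ hd.ne]
    ring
  refine ⟨(z.im - (start θ σ m).im) / (dir θ m).im, ⟨?_, ?_⟩, him, ?_⟩
  · exact div_nonneg_of_nonpos (by linarith [h.1]) hd.le
  · rw [div_le_one_of_neg hd]; linarith [h.2]
  · rw [← cross_of_im_eq him.symm, ← sub_sub, cross_sub_right _ (z - start θ σ m), cross_mul_right,
      cross_self]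
    ring

theorem RightOf.exists_on_edge (hθ : IsAdmissible θ) (hn : 0 < n) {σ : Equiv.Perm (Fin n)} {z : ℂ}
    (hr : RightOf θ σ z) (hl : LeftOf θ σ z) (h0 : z.im ≤ 0) (h1 : (∑ x, dir θ x).im ≤ z.im) :
    ∃ m, ∃ s ∈ Set.Icc (0 : ℝ) 1, z = start θ σ m + s * dir θ m := by
  obtain ⟨m, hm⟩ := exists_inStrip hn σ h0 h1
  obtain ⟨s, hs, e1, e2⟩ := hθ.exists_on_edge hm
  refine ⟨m, s, hs, Complex.ext ?_ e1.symm⟩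
  have : cross (dir θ m) (z - start θ σ m) = 0 := le_antisymm (hl m hm) (hr m hm)
  rw [this] at e2
  have h3 := (mul_eq_zero.1 e2.symm).resolve_left (by linarith [hθ.im_dir_neg m])
  linarith

/-- The difference is a combination of directions whose coefficients are nonpositive for labels
below `m` and nonnegative for labels above `m`. These are the signs of the determinants with `dir θ
m`, so every term is nonnegative. -/
theorem IsAdmissible.left_halfPlane_sum (hθ : IsAdmissible θ) (A : Finset (Fin n)) (m : Fin n) :
    0 ≤ cross (dir θ m) (∑ x ∈ A, dir θ x - start θ 1 m) := by
  have : ∑ x ∈ A, dir θ x - start θ 1 m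
      = ∑ x, ((if x ∈ A then (1 : ℝ) else 0) - if x < m then (1 : ℝ) else 0 : ℝ) * dir θ x := by
    simp only [start, Finset.sum_filter, Complex.ofReal_sub, sub_mul, Finset.sum_sub_distrib]
    congr 1
    · simp [apply_ite, ite_mul]
    · simp only [apply_ite, ite_mul, Complex.ofReal_one, Complex.ofReal_zero, one_mul, zero_mul]
      rfl
  rw [this, cross_sum_right]
  refine Finset.sum_nonneg fun x _ => ?_
  rw [cross_mul_right]
  rcases lt_trichotomy x m with h | h | h
  · have := hθ.cross_neg h
    split_ifs <;> nlinarith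
  · rw [h, cross_self]; simp
  · have := hθ.cross_pos h
    have h' := h.not_gt
    split_ifs <;> nlinarith

theorem IsAdmissible.right_halfPlane_sum (hθ : IsAdmissible θ) (A : Finset (Fin n)) (m : Fin n) :
    cross (dir θ m) (∑ x ∈ A, dir θ x - start θ Fin.revPerm m) ≤ 0 := by
  have : ∑ x ∈ A, dir θ x - start θ Fin.revPerm m
      = ∑ x, ((if x ∈ A then (1 : ℝ) else 0) - if m < x then (1 : ℝ) else 0 : ℝ) * dir θ x := by
    simp only [start, Finset.sum_filter, Complex.ofReal_sub, sub_mul, Finset.sum_sub_distrib]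
    congr 1
    · simp [apply_ite, ite_mul]
    · simp [apply_ite, ite_mul]
  rw [this, cross_sum_right]
  refine Finset.sum_nonpos fun x _ => ?_
  rw [cross_mul_right]
  rcases lt_trichotomy x m with h | h | h
  · have := hθ.cross_neg h
    have h' := h.not_gt
    split_ifs <;> nlinarith
  · rw [h, cross_self]; simp
  · have := hθ.cross_pos h
    split_ifs <;> nlinarith

theorem rightVertex_eq_sum (θ : Fin n → ℝ) (k : ℕ) :
    rightVertex θ k = ∑ x with (Fin.rev x : ℕ) < k, dir θ x := by
  unfold rightVertex
  refine Finset.sum_equiv Fin.revPerm (fun x => ?_) (fun x _ => rfl)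
  simp only [Finset.mem_filter, Finset.mem_univ, true_and, Fin.revPerm_apply, Fin.rev_rev]

/-- The polygon lies in the half-planes bounded by its sides. -/
theorem IsAdmissible.halfPlane_of_mem_polygon (hθ : IsAdmissible θ) {z : ℂ}
    (hz : z ∈ polygon θ) :
    z.im ≤ 0 ∧ (∑ x, dir θ x).im ≤ z.im ∧
      (∀ m, 0 ≤ cross (dir θ m) (z - start θ 1 m)) ∧
      ∀ m, cross (dir θ m) (z - start θ Fin.revPerm m) ≤ 0 := by
  have hsum : ∀ A : Finset (Fin n), (∑ x, dir θ x).im ≤ (∑ x ∈ A, dir θ x).im := fun A => by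
    rw [← Finset.sum_sdiff A.subset_univ, Complex.add_im]
    linarith [hθ.im_sum_nonpos (Finset.univ \ A)]
  refine convexHull_min (t := {z : ℂ | z.im ≤ 0 ∧ (∑ x, dir θ x).im ≤ z.im ∧
      (∀ m, 0 ≤ cross (dir θ m) (z - start θ 1 m)) ∧
      ∀ m, cross (dir θ m) (z - start θ Fin.revPerm m) ≤ 0}) ?_ ?_ hz
  · rintro z ⟨k, -, rfl | rfl⟩
    · exact ⟨hθ.im_sum_nonpos _, hsum _, hθ.left_halfPlane_sum _, hθ.right_halfPlane_sum _⟩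
    · rw [rightVertex_eq_sum]
      exact ⟨hθ.im_sum_nonpos _, hsum _, hθ.left_halfPlane_sum _, hθ.right_halfPlane_sum _⟩
  · rintro z ⟨z1, z2, z3, z4⟩ w ⟨w1, w2, w3, w4⟩ a b ha hb hab
    have e : ∀ m p, cross (dir θ m) (a • z + b • w - p)
        = a * cross (dir θ m) (z - p) + b * cross (dir θ m) (w - p) := by
      intro m p
      rw [← cross_mul_right, ← cross_mul_right, ← cross_add_right]
      congr 1
      have : (a : ℂ) + b = 1 := by exact_mod_cast hab
      simp only [Complex.real_smul]
      linear_combination p * this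
    have eim : (a • z + b • w).im = a * z.im + b * w.im := by simp
    refine ⟨?_, ?_, fun m => ?_, fun m => ?_⟩
    · rw [eim]; nlinarith
    · rw [eim]; nlinarith
    · rw [e]; have := z3 m; have := w3 m; positivity
    · rw [e]; have := z4 m; have := w4 m; nlinarith

theorem IsAdmissible.rightOf_of_mem_polygon (hθ : IsAdmissible θ) {z : ℂ} (hz : z ∈ polygon θ) :
    RightOf θ 1 z := fun m _ => (hθ.halfPlane_of_mem_polygon hz).2.2.1 m

theorem convex_polygon (θ : Fin n → ℝ) : Convex ℝ (polygon θ) := convex_convexHull ℝ _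

theorem add_mul_mem_of_convex {s : Set ℂ} (hs : Convex ℝ s) {p u : ℂ} (h0 : p ∈ s)
    (h1 : p + u ∈ s) {a : ℝ} (ha : a ∈ Set.Icc (0 : ℝ) 1) : p + a * u ∈ s := by
  have := hs.add_smul_sub_mem h0 h1 ha
  simpa using this

theorem mem_of_convex_of_im_eq {s : Set ℂ} (hs : Convex ℝ s) {p q z : ℂ} (hp : p ∈ s) (hq : q ∈ s)
    (hpi : p.im = z.im) (hqi : q.im = z.im) (h1 : p.re ≤ z.re) (h2 : z.re ≤ q.re) : z ∈ s := by
  rcases (h1.trans h2).eq_or_lt with h | h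
  · have : z = p := Complex.ext (by linarith) hpi.symm
    rwa [this]
  · have hd : 0 < q.re - p.re := by linarith
    have := hs.add_smul_sub_mem hp hq (t := (z.re - p.re) / (q.re - p.re))
      ⟨div_nonneg (by linarith) hd.le, (div_le_one hd).2 (by linarith)⟩
    convert this using 1
    apply Complex.ext
    · rw [Complex.add_re, Complex.smul_re, Complex.sub_re, smul_eq_mul, div_mul_cancel₀ _ hd.ne']
      ring
    · rw [Complex.add_im, Complex.smul_im, Complex.sub_im, hpi, hqi]; simp

theorem left_start_mem_polygon (θ : Fin n → ℝ) (m : Fin n) :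
    start θ 1 m ∈ polygon θ ∧ start θ 1 m + dir θ m ∈ polygon θ :=
  ⟨subset_convexHull ℝ _ ⟨m, m.2.le, Or.inl (leftVertex_eq_start θ m).symm⟩,
    subset_convexHull ℝ _ ⟨m + 1, m.2, Or.inl (leftVertex_succ θ m).symm⟩⟩

theorem right_start_mem_polygon (θ : Fin n → ℝ) (m : Fin n) :
    start θ Fin.revPerm m ∈ polygon θ ∧ start θ Fin.revPerm m + dir θ m ∈ polygon θ :=
  ⟨subset_convexHull ℝ _ ⟨m.rev, m.rev.2.le, Or.inr (rightVertex_eq_start θ m).symm⟩,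
    subset_convexHull ℝ _ ⟨m.rev + 1, m.rev.2, Or.inr (rightVertex_succ θ m).symm⟩⟩

/-- The point lies on the horizontal chord between the leftside and the rightside boundary at its
height, so convexity applies. -/
theorem IsAdmissible.mem_polygon (hθ : IsAdmissible θ) (hn : 0 < n) {z : ℂ} (h0 : z.im ≤ 0)
    (h1 : (∑ x, dir θ x).im ≤ z.im) (hr : RightOf θ 1 z) (hl : LeftOf θ Fin.revPerm z) :
    z ∈ polygon θ := by
  obtain ⟨m, hm⟩ := exists_inStrip hn 1 h0 h1
  obtain ⟨s, hs, e1, e2⟩ := hθ.exists_on_edge hm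
  obtain ⟨m', hm'⟩ := exists_inStrip hn Fin.revPerm h0 h1
  obtain ⟨s', hs', e1', e2'⟩ := hθ.exists_on_edge hm'
  have i1 := hr m hm
  have i2 := hl m' hm'
  rw [e2] at i1
  rw [e2'] at i2
  have l := left_start_mem_polygon θ m
  have r := right_start_mem_polygon θ m'
  refine mem_of_convex_of_im_eq (convex_polygon θ)
    (add_mul_mem_of_convex (convex_polygon θ) l.1 l.2 hs)
    (add_mul_mem_of_convex (convex_polygon θ) r.1 r.2 hs') e1 e1' ?_ ?_
  · have := hθ.im_dir_neg m; nlinarith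
  · have := hθ.im_dir_neg m'; nlinarith

theorem IsAdmissible.sum_mem_polygon (hθ : IsAdmissible θ) (hn : 0 < n) (A : Finset (Fin n)) :
    ∑ x ∈ A, dir θ x ∈ polygon θ := by
  refine hθ.mem_polygon hn (hθ.im_sum_nonpos _) ?_ (fun m _ => hθ.left_halfPlane_sum A m)
    (fun m _ => hθ.right_halfPlane_sum A m)
  rw [← Finset.sum_sdiff A.subset_univ, Complex.add_im]
  linarith [hθ.im_sum_nonpos (Finset.univ \ A)]

theorem IsAdmissible.edge_mem_polygon (hθ : IsAdmissible θ) (σ : Equiv.Perm (Fin n)) (m : Fin n)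
    {s : ℝ} (hs : s ∈ Set.Icc (0 : ℝ) 1) : start θ σ m + s * dir θ m ∈ polygon θ := by
  refine add_mul_mem_of_convex (convex_polygon θ) (hθ.sum_mem_polygon m.pos _) ?_ hs
  have := hθ.sum_mem_polygon m.pos (Finset.univ.filter fun x => σ x ≤ σ m)
  rwa [← start_add_dir] at this

/-! ### Rhombus coordinates and the topology of tiles -/

/-- The first coordinate of `w` in the basis `dir θ i`, `dir θ j`. -/
noncomputable def coordI (θ : Fin n → ℝ) (i j : Fin n) (w : ℂ) : ℝ :=
  -cross (dir θ j) w / cross (dir θ i) (dir θ j)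

/-- The second coordinate of `w` in the basis `dir θ i`, `dir θ j`. -/
noncomputable def coordJ (θ : Fin n → ℝ) (i j : Fin n) (w : ℂ) : ℝ :=
  cross (dir θ i) w / cross (dir θ i) (dir θ j)

theorem continuous_coordI (θ : Fin n → ℝ) (i j : Fin n) : Continuous (coordI θ i j) :=
  (continuous_cross_right _).neg.div_const _

theorem continuous_coordJ (θ : Fin n → ℝ) (i j : Fin n) : Continuous (coordJ θ i j) :=
  (continuous_cross_right _).div_const _

theorem eq_coord (hθ : IsAdmissible θ) {i j : Fin n} (hij : i < j) (w : ℂ) :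
    w = coordI θ i j w * dir θ i + coordJ θ i j w * dir θ j := by
  have hD := (hθ.cross_pos hij).ne'
  apply Complex.ext
  · rw [Complex.add_re, Complex.re_ofReal_mul, Complex.re_ofReal_mul, coordI, coordJ]
    field_simp
    simp only [cross]; ring
  · rw [Complex.add_im, Complex.im_ofReal_mul, Complex.im_ofReal_mul, coordI, coordJ]
    field_simp
    simp only [cross]; ring

theorem coordI_add (hθ : IsAdmissible θ) {i j : Fin n} (hij : i < j) (a b : ℝ) :
    coordI θ i j (a * dir θ i + b * dir θ j) = a := by
  have hD := (hθ.cross_pos hij).ne'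
  rw [coordI, cross_add_right, cross_mul_right, cross_mul_right, cross_self,
    cross_swap (dir θ j)]
  field_simp
  ring

theorem coordJ_add (hθ : IsAdmissible θ) {i j : Fin n} (hij : i < j) (a b : ℝ) :
    coordJ θ i j (a * dir θ i + b * dir θ j) = b := by
  have hD := (hθ.cross_pos hij).ne'
  rw [coordJ, cross_add_right, cross_mul_right, cross_mul_right, cross_self]
  field_simp
  ring

theorem mem_carrier_iff (hθ : IsAdmissible θ) (t : Tile n) (z : ℂ) :
    z ∈ t.carrier θ ↔ coordI θ t.i t.j (z - t.top) ∈ Set.Icc (0 : ℝ) 1 ∧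
      coordJ θ t.i t.j (z - t.top) ∈ Set.Icc (0 : ℝ) 1 := by
  constructor
  · rintro ⟨a, ha, b, hb, rfl⟩
    rw [add_assoc, add_sub_cancel_left, coordI_add hθ t.lt, coordJ_add hθ t.lt]
    exact ⟨ha, hb⟩
  · rintro ⟨ha, hb⟩
    refine ⟨_, ha, _, hb, ?_⟩
    rw [add_assoc, ← eq_coord hθ t.lt]; ring

theorem isClosed_carrier (hθ : IsAdmissible θ) (t : Tile n) : IsClosed (t.carrier θ) := by
  have : t.carrier θ = (fun z => coordI θ t.i t.j (z - t.top)) ⁻¹' Set.Icc (0 : ℝ) 1 ∩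
      (fun z => coordJ θ t.i t.j (z - t.top)) ⁻¹' Set.Icc (0 : ℝ) 1 := by
    ext z; exact mem_carrier_iff hθ t z
  rw [this]
  exact (isClosed_Icc.preimage ((continuous_coordI θ _ _).comp (by fun_prop))).inter
    (isClosed_Icc.preimage ((continuous_coordJ θ _ _).comp (by fun_prop)))

theorem mem_interior_carrier (hθ : IsAdmissible θ) (t : Tile n) {a b : ℝ}
    (ha : a ∈ Set.Ioo (0 : ℝ) 1) (hb : b ∈ Set.Ioo (0 : ℝ) 1) :
    t.top + a * dir θ t.i + b * dir θ t.j ∈ interior (t.carrier θ) := by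
  refine mem_interior.2 ⟨(fun z => coordI θ t.i t.j (z - t.top)) ⁻¹' Set.Ioo (0 : ℝ) 1 ∩
      (fun z => coordJ θ t.i t.j (z - t.top)) ⁻¹' Set.Ioo (0 : ℝ) 1, ?_, ?_, ?_⟩
  · rintro z ⟨h1, h2⟩
    exact (mem_carrier_iff hθ t z).2 ⟨Set.Ioo_subset_Icc_self h1, Set.Ioo_subset_Icc_self h2⟩
  · exact (isOpen_Ioo.preimage ((continuous_coordI θ _ _).comp (by fun_prop))).inter
      (isOpen_Ioo.preimage ((continuous_coordJ θ _ _).comp (by fun_prop)))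
  · simp only [Set.mem_inter_iff, Set.mem_preimage]
    rw [add_assoc, add_sub_cancel_left, coordI_add hθ t.lt, coordJ_add hθ t.lt]
    exact ⟨ha, hb⟩

theorem convex_carrier (θ : Fin n → ℝ) (t : Tile n) : Convex ℝ (t.carrier θ) := by
  rintro z ⟨a, ha, b, hb, rfl⟩ w ⟨a', ha', b', hb', rfl⟩ r s hr hs hrs
  refine ⟨r * a + s * a', convex_Icc (0 : ℝ) 1 ha ha' hr hs hrs,
    r * b + s * b', convex_Icc (0 : ℝ) 1 hb hb' hr hs hrs, ?_⟩
  have : (r : ℂ) + s = 1 := by exact_mod_cast hrs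
  simp only [Complex.real_smul, Complex.ofReal_add, Complex.ofReal_mul]
  linear_combination t.top * this

theorem subset_closure_interior_carrier (hθ : IsAdmissible θ) (t : Tile n) :
    t.carrier θ ⊆ closure (interior (t.carrier θ)) := by
  rw [(convex_carrier θ t).closure_interior_eq_closure_of_nonempty_interior
    ⟨_, mem_interior_carrier hθ t (a := 1 / 2) (b := 1 / 2) (by norm_num) (by norm_num)⟩]
  exact subset_closure

/-- A closed tile is contained in the closure of its interior, so an open set that misses the
interior misses the whole tile. -/
theorem notMem_of_mem_interior (hθ : IsAdmissible θ) {s t : Tile n}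
    (h : Disjoint (interior (s.carrier θ)) (interior (t.carrier θ))) {z : ℂ}
    (hz : z ∈ interior (s.carrier θ)) : z ∉ t.carrier θ := fun hzt => by
  have := (h.closure_right isOpen_interior).le_bot
    ⟨hz, subset_closure_interior_carrier hθ t hzt⟩
  exact this

/-! ### The region swept by a flip is one rhombus -/

section flip

variable {σ : Equiv.Perm (Fin n)} {i j : Fin n} {a b : ℝ} {z : ℂ}

theorem im_of_coord (hz : z = start θ σ i + a * dir θ i + b * dir θ j) :
    z.im = (start θ σ i).im + a * (dir θ i).im + b * (dir θ j).im := by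
  rw [hz]; simp

theorem cross_start_i (hz : z = start θ σ i + a * dir θ i + b * dir θ j) :
    cross (dir θ i) (z - start θ σ i) = b * cross (dir θ i) (dir θ j) := by
  rw [hz, add_assoc, add_sub_cancel_left, cross_add_right, cross_mul_right, cross_mul_right,
    cross_self]
  ring

theorem cross_start_j (h : (σ j : ℕ) = σ i + 1)
    (hz : z = start θ σ i + a * dir θ i + b * dir θ j) :
    cross (dir θ j) (z - start θ σ j) = (1 - a) * cross (dir θ i) (dir θ j) := by
  have : z - start θ σ j = ((a - 1 : ℝ) : ℂ) * dir θ i + b * dir θ j := by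
    rw [hz, start_next θ h]; push_cast; ring
  rw [this, cross_add_right, cross_mul_right, cross_mul_right, cross_self, cross_swap (dir θ j)]
  ring

theorem cross_swap_start_j (h : (σ j : ℕ) = σ i + 1)
    (hz : z = start θ σ i + a * dir θ i + b * dir θ j) :
    cross (dir θ j) (z - start θ (σ * Equiv.swap i j) j) = -a * cross (dir θ i) (dir θ j) := by
  rw [start_swap_right θ h, hz, add_assoc, add_sub_cancel_left, cross_add_right, cross_mul_right,
    cross_mul_right, cross_self, cross_swap (dir θ j)]
  ring

theorem cross_swap_start_i (h : (σ j : ℕ) = σ i + 1)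
    (hz : z = start θ σ i + a * dir θ i + b * dir θ j) :
    cross (dir θ i) (z - start θ (σ * Equiv.swap i j) i)
      = (b - 1) * cross (dir θ i) (dir θ j) := by
  have : z - start θ (σ * Equiv.swap i j) i = a * dir θ i + ((b - 1 : ℝ) : ℂ) * dir θ j := by
    rw [hz, start_swap_left θ h]; push_cast; ring
  rw [this, cross_add_right, cross_mul_right, cross_mul_right, cross_self]
  ring

/-- The point is in the strip of the edge `i` or of the edge `j`. That edge gives one of the two
bounds, and the height of the point then gives the other. -/
theorem RightOf.coord_bounds (hθ : IsAdmissible θ) (hij : i < j) (h : (σ j : ℕ) = σ i + 1)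
    (hz : z = start θ σ i + a * dir θ i + b * dir θ j) (hr : RightOf θ σ z)
    (h0 : z.im ≤ (start θ σ i).im)
    (h1 : (start θ σ i).im + (dir θ i).im + (dir θ j).im ≤ z.im) : a ≤ 1 ∧ 0 ≤ b := by
  have hD := hθ.cross_pos hij
  have hi := hθ.im_dir_neg i
  have hj := hθ.im_dir_neg j
  have hz' := im_of_coord hz
  have ri := hr i
  have rj := hr j
  rw [cross_start_i hz] at ri
  rw [cross_start_j h hz] at rj
  unfold InStrip at ri rj
  rw [start_next θ h, Complex.add_im] at rj
  rcases le_total ((start θ σ i).im + (dir θ i).im) z.im with h2 | h2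
  · have hb : 0 ≤ b := nonneg_of_mul_nonneg_left (ri ⟨h0, h2⟩) hD
    exact ⟨by nlinarith, hb⟩
  · have ha : 0 ≤ 1 - a := nonneg_of_mul_nonneg_left (rj ⟨h2, h1⟩) hD
    exact ⟨by linarith, by nlinarith⟩

/-- A point that the path passes during a flip lies in the rhombus off its two right edges, which
belong to the new path. This serves twice: for covering when tilings are built, and for separating
tiles in the sweep. -/
theorem RightOf.coord_bounds_of_not_swap (hθ : IsAdmissible θ) (hij : i < j)
    (h : (σ j : ℕ) = σ i + 1) (hz : z = start θ σ i + a * dir θ i + b * dir θ j)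
    (hr : RightOf θ σ z) (hr' : ¬ RightOf θ (σ * Equiv.swap i j) z) :
    z.im < (start θ σ i).im ∧ (start θ σ i).im + (dir θ i).im + (dir θ j).im < z.im ∧
      a ∈ Set.Ioc (0 : ℝ) 1 ∧ b ∈ Set.Ico (0 : ℝ) 1 := by
  have hD := hθ.cross_pos hij
  have hi := hθ.im_dir_neg i
  have hj := hθ.im_dir_neg j
  have hz' := im_of_coord hz
  have key : z.im ≤ (start θ σ i).im ∧ (start θ σ i).im + (dir θ i).im + (dir θ j).im ≤ z.im ∧
      0 < a ∧ b < 1 := by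
    unfold RightOf at hr'
    push Not at hr'
    obtain ⟨m, hm, hneg⟩ := hr'
    by_cases hmi : m = i
    · subst hmi
      rw [cross_swap_start_i h hz] at hneg
      unfold InStrip at hm
      rw [start_swap_left θ h, Complex.add_im] at hm
      have hb : b - 1 < 0 := by
        by_contra hb
        exact absurd hneg (not_lt.2 (mul_nonneg (not_lt.1 hb) hD.le))
      exact ⟨by linarith [hm.1], by linarith [hm.2], by nlinarith [hm.1], by linarith⟩
    by_cases hmj : m = j
    · subst hmj
      rw [cross_swap_start_j h hz] at hneg
      unfold InStrip at hm
      rw [start_swap_right θ h] at hm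
      have ha : 0 < a := by
        by_contra ha
        exact absurd hneg (not_lt.2 (mul_nonneg (by linarith) hD.le))
      exact ⟨hm.1, by linarith [hm.2], ha, by nlinarith [hm.2]⟩
    · have := start_swap_of_ne θ h hmi hmj
      unfold InStrip at hm
      rw [this] at hm hneg
      exact absurd hneg (not_lt.2 (hr m hm))
  obtain ⟨k1, k2, k3, k4⟩ := key
  obtain ⟨k5, k6⟩ := hr.coord_bounds hθ hij h hz k1 k2
  exact ⟨by nlinarith, by nlinarith, ⟨k3, k5⟩, ⟨k6, k4⟩⟩

/-- A flip only moves the path to the right. Within the heights of the rhombus, being left of the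
old path means `b ≤ 0` or `1 ≤ a`, and either one puts the point left of the new edges. -/
theorem LeftOf.swap (hθ : IsAdmissible θ) (hij : i < j)
    (h : (σ j : ℕ) = σ i + 1) (hl : LeftOf θ σ z) : LeftOf θ (σ * Equiv.swap i j) z := by
  have hD := hθ.cross_pos hij
  have hi := hθ.im_dir_neg i
  have hj := hθ.im_dir_neg j
  obtain ⟨a, b, hz⟩ : ∃ a b : ℝ, z = start θ σ i + a * dir θ i + b * dir θ j :=
    ⟨_, _, by rw [add_assoc, ← eq_coord hθ hij (z - start θ σ i)]; ring⟩
  have hz' := im_of_coord hz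
  have li := hl i
  have lj := hl j
  rw [cross_start_i hz] at li
  rw [cross_start_j h hz] at lj
  unfold InStrip at li lj
  rw [start_next θ h, Complex.add_im] at lj
  have key : z.im ≤ (start θ σ i).im →
      (start θ σ i).im + (dir θ i).im + (dir θ j).im ≤ z.im → b ≤ 0 ∨ 1 ≤ a := by
    intro k1 k2
    rcases le_total ((start θ σ i).im + (dir θ i).im) z.im with h2 | h2
    · left
      by_contra hb
      exact absurd (li ⟨k1, h2⟩) (not_le.2 (mul_pos (not_le.1 hb) hD))
    · right
      by_contra ha
      exact absurd (lj ⟨h2, k2⟩) (not_le.2 (mul_pos (by linarith) hD))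
  intro m hm
  by_cases hmi : m = i
  · subst hmi
    rw [cross_swap_start_i h hz]
    unfold InStrip at hm
    rw [start_swap_left θ h, Complex.add_im] at hm
    refine mul_nonpos_of_nonpos_of_nonneg ?_ hD.le
    rcases key (by linarith [hm.1]) (by linarith [hm.2]) with k | k
    · linarith
    · nlinarith [hm.2]
  by_cases hmj : m = j
  · subst hmj
    rw [cross_swap_start_j h hz]
    unfold InStrip at hm
    rw [start_swap_right θ h] at hm
    refine mul_nonpos_of_nonpos_of_nonneg ?_ hD.le
    rcases key hm.1 (by linarith [hm.2]) with k | k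
    · nlinarith [hm.1]
    · linarith
  · have := start_swap_of_ne θ h hmi hmj
    unfold InStrip at hm
    rw [this] at hm ⊢
    exact hl m hm

/-- A point at the height of the rhombus between the paths `σ` and `σ * swap i j` that lies on the
path `σ` away from the rhombus is on the edge. -/
theorem cross_eq_zero_of_inStrip_of_ne (hθ : IsAdmissible θ) (h : (σ j : ℕ) = σ i + 1)
    (ha : a ∈ Set.Icc (0 : ℝ) 1) (hb : b ∈ Set.Icc (0 : ℝ) 1)
    (hz : z = start θ σ i + a * dir θ i + b * dir θ j) {m : Fin n} (hmi : m ≠ i) (hmj : m ≠ j)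
    (hm : InStrip θ σ m z) : cross (dir θ m) (z - start θ σ m) = 0 := by
  have hi := hθ.im_dir_neg i
  have hj := hθ.im_dir_neg j
  have hz' := im_of_coord hz
  have h1 : (σ m : ℕ) ≠ σ i := fun e => hmi (σ.injective (Fin.ext e))
  have h2 : (σ m : ℕ) ≠ σ j := fun e => hmj (σ.injective (Fin.ext e))
  have a0 := ha.1
  have a1 := ha.2
  have b0 := hb.1
  have b1 := hb.2
  rcases lt_or_gt_of_ne h1 with h3 | h3
  · have hlt : σ m < σ i := h3
    have hm2 := hm.2
    rw [← Complex.add_im] at hm2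
    have hle := hθ.im_start_le hlt
    have e : (start θ σ m + dir θ m).im = (start θ σ i).im := by nlinarith
    have e1 := (hθ.start_add_eq_or_lt hlt).resolve_right (by rw [e]; exact lt_irrefl _)
    have a' : a = 0 := by nlinarith
    have b' : b = 0 := by nlinarith
    rw [hz, a', b', ← e1]
    simp [cross_self]
  · have hlt : σ j < σ m := by rw [Fin.lt_def]; omega
    have hm1 := hm.1
    have hle := hθ.im_start_le hlt
    have hsj := start_next θ h
    have e0 : (start θ σ j + dir θ j).im
        = (start θ σ i).im + (dir θ i).im + (dir θ j).im := by rw [hsj]; simp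
    have e : (start θ σ j + dir θ j).im = (start θ σ m).im := by nlinarith
    have e1 := (hθ.start_add_eq_or_lt hlt).resolve_right (by rw [e]; exact lt_irrefl _)
    have a' : a = 1 := by nlinarith
    have b' : b = 1 := by nlinarith
    rw [hz, a', b', ← e1, hsj]
    simp [cross]

theorem rightOf_of_coord (hθ : IsAdmissible θ) (hij : i < j) (h : (σ j : ℕ) = σ i + 1)
    (ha : a ∈ Set.Icc (0 : ℝ) 1) (hb : b ∈ Set.Icc (0 : ℝ) 1)
    (hz : z = start θ σ i + a * dir θ i + b * dir θ j) : RightOf θ σ z := by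
  have hD := hθ.cross_pos hij
  intro m hm
  by_cases hmi : m = i
  · subst hmi
    rw [cross_start_i hz]
    exact mul_nonneg hb.1 hD.le
  by_cases hmj : m = j
  · subst hmj
    rw [cross_start_j h hz]
    exact mul_nonneg (by linarith [ha.2]) hD.le
  exact (cross_eq_zero_of_inStrip_of_ne hθ h ha hb hz hmi hmj hm).ge

theorem leftOf_swap_of_coord (hθ : IsAdmissible θ) (hij : i < j) (h : (σ j : ℕ) = σ i + 1)
    (ha : a ∈ Set.Icc (0 : ℝ) 1) (hb : b ∈ Set.Icc (0 : ℝ) 1)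
    (hz : z = start θ σ i + a * dir θ i + b * dir θ j) :
    LeftOf θ (σ * Equiv.swap i j) z := by
  have hD := hθ.cross_pos hij
  intro m hm
  by_cases hmi : m = i
  · subst hmi
    rw [cross_swap_start_i h hz]
    exact mul_nonpos_of_nonpos_of_nonneg (by linarith [hb.2]) hD.le
  by_cases hmj : m = j
  · subst hmj
    rw [cross_swap_start_j h hz]
    exact mul_nonpos_of_nonpos_of_nonneg (by linarith [ha.1]) hD.le
  have e := start_swap_of_ne θ h hmi hmj
  unfold InStrip at hm
  rw [e] at hm ⊢
  exact (cross_eq_zero_of_inStrip_of_ne hθ h ha hb hz hmi hmj hm).le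

end flip

/-! ### Existence of a leftmost tile -/

/-- Finitely many pairwise disjoint arcs, each a graph over an open interval, have a leftmost one:
an arc that precedes every other arc at every common height. -/
theorem exists_leftmost {ι : Type*} [DecidableEq ι] (lo hi : ι → ℝ) (c : ι → ℝ → ℝ) :
    ∀ R : Finset ι, R.Nonempty → (∀ t ∈ R, lo t < hi t) →
    (∀ s ∈ R, ∀ t ∈ R, s ≠ t → ∀ y y', y ∈ Set.Ioo (lo s) (hi s) → y ∈ Set.Ioo (lo t) (hi t) →
      y' ∈ Set.Ioo (lo s) (hi s) → y' ∈ Set.Ioo (lo t) (hi t) → c s y < c t y → c s y' < c t y') →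
    (∀ s ∈ R, ∀ t ∈ R, s ≠ t → ∀ y, y ∈ Set.Ioo (lo s) (hi s) → y ∈ Set.Ioo (lo t) (hi t) →
      c s y ≠ c t y) →
    ∃ t ∈ R, ∀ s ∈ R, s ≠ t → ∀ y, y ∈ Set.Ioo (lo s) (hi s) → y ∈ Set.Ioo (lo t) (hi t) →
      c t y < c s y := by
  intro R
  induction R using Finset.strongInduction with
  | H R ih =>
  intro hR hlt hcons hne
  -- The arc with the highest lower end is removed, so that just above `lo t0` every arc that shares
  -- some height with `t0` is present.
  obtain ⟨t0, ht0, hmax⟩ := R.exists_max_image lo hR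
  by_cases hE : (R.erase t0).Nonempty
  swap
  · refine ⟨t0, ht0, fun s hs hst => ?_⟩
    exact absurd ⟨s, Finset.mem_erase.2 ⟨hst, hs⟩⟩ hE
  have sub : ∀ {x}, x ∈ R.erase t0 → x ∈ R := fun hx => Finset.mem_of_mem_erase hx
  obtain ⟨m, hm, hmin⟩ := ih (R.erase t0) (Finset.erase_ssubset ht0) hE
    (fun t ht => hlt t (sub ht)) (fun s hs t ht => hcons s (sub hs) t (sub ht))
    (fun s hs t ht => hne s (sub hs) t (sub ht))
  have hm0 : m ≠ t0 := Finset.ne_of_mem_erase hm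
  by_cases hcase : ∃ y, y ∈ Set.Ioo (lo t0) (hi t0) ∧ y ∈ Set.Ioo (lo m) (hi m) ∧ c t0 y < c m y
  · obtain ⟨y, hy0, hym, hlty⟩ := hcase
    refine ⟨t0, ht0, fun s hs hst z hzs hz0 => ?_⟩
    refine lt_of_le_of_ne (not_lt.1 fun hsz => ?_) (hne s hs t0 ht0 hst z hzs hz0).symm
    by_cases hsm : s = m
    · subst hsm
      exact lt_asymm hlty (hcons s hs t0 ht0 hst z y hzs hz0 hym hy0 hsz)
    -- If `s` preceded `t0`, then at the height `w` the order would be `s`, `t0`, `m`, against `m`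
    -- being leftmost among the others.
    obtain ⟨w, hw1, hw2⟩ := exists_between (show lo t0 < min (hi s) (min (hi t0) (hi m)) from
      lt_min (hz0.1.trans hzs.2) (lt_min (hlt t0 ht0) (hy0.1.trans hym.2)))
    rw [lt_min_iff, lt_min_iff] at hw2
    have ws : w ∈ Set.Ioo (lo s) (hi s) := ⟨(hmax s hs).trans_lt hw1, hw2.1⟩
    have w0 : w ∈ Set.Ioo (lo t0) (hi t0) := ⟨hw1, hw2.2.1⟩
    have wm : w ∈ Set.Ioo (lo m) (hi m) := ⟨(hmax m (sub hm)).trans_lt hw1, hw2.2.2⟩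
    have h1 := hcons s hs t0 ht0 hst z w hzs hz0 ws w0 hsz
    have h2 := hcons t0 ht0 m (sub hm) hm0.symm y w hy0 hym w0 wm hlty
    have h3 := hmin s (Finset.mem_erase.2 ⟨hst, hs⟩) hsm w ws wm
    linarith
  · refine ⟨m, sub hm, fun s hs hsm y hys hym => ?_⟩
    by_cases hs0 : s = t0
    · subst hs0
      push Not at hcase
      exact lt_of_le_of_ne (hcase y hys hym) (hne m (sub hm) s hs hsm.symm y hym hys)
    · exact hmin s (Finset.mem_erase.2 ⟨hs0, hs⟩) hsm y hys hym

namespace Tile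

/-- The height of the bottom vertex of a tile. -/
noncomputable def bot (θ : Fin n → ℝ) (t : Tile n) : ℝ :=
  t.top.im + (dir θ t.i).im + (dir θ t.j).im

/-- The point at height `y` on the vertical diagonal of a tile. -/
noncomputable def diag (θ : Fin n → ℝ) (t : Tile n) (y : ℝ) : ℂ :=
  t.top + ((y - t.top.im) / ((dir θ t.i).im + (dir θ t.j).im) : ℝ) * dir θ t.i +
    ((y - t.top.im) / ((dir θ t.i).im + (dir θ t.j).im) : ℝ) * dir θ t.j

end Tile

open Tile

theorem im_diag (hθ : IsAdmissible θ) (t : Tile n) (y : ℝ) : (t.diag θ y).im = y := by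
  have h : (dir θ t.i).im + (dir θ t.j).im ≠ 0 := by
    linarith [hθ.im_dir_neg t.i, hθ.im_dir_neg t.j]
  rw [diag, Complex.add_im, Complex.add_im, Complex.im_ofReal_mul, Complex.im_ofReal_mul]
  field_simp
  ring

theorem diag_mem_interior (hθ : IsAdmissible θ) (t : Tile n) {y : ℝ}
    (hy : y ∈ Set.Ioo (t.bot θ) t.top.im) : t.diag θ y ∈ interior (t.carrier θ) := by
  have h : (dir θ t.i).im + (dir θ t.j).im < 0 := by
    linarith [hθ.im_dir_neg t.i, hθ.im_dir_neg t.j]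
  have h1 := hy.1
  have h2 := hy.2
  unfold bot at h1
  have : (y - t.top.im) / ((dir θ t.i).im + (dir θ t.j).im) ∈ Set.Ioo (0 : ℝ) 1 :=
    ⟨div_pos_of_neg_of_neg (by linarith) h, (div_lt_one_of_neg h).2 (by linarith)⟩
  exact mem_interior_carrier hθ t this this

theorem continuous_diag (θ : Fin n → ℝ) (t : Tile n) : Continuous fun y => (t.diag θ y).re := by
  unfold diag
  simp only [Complex.add_re, Complex.re_ofReal_mul]
  fun_prop

theorem im_mem_Icc_of_mem_carrier (hθ : IsAdmissible θ) (t : Tile n) {z : ℂ}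
    (hz : z ∈ t.carrier θ) : z.im ∈ Set.Icc (t.bot θ) t.top.im := by
  obtain ⟨a, ⟨a0, a1⟩, b, ⟨b0, b1⟩, rfl⟩ := hz
  have hi := hθ.im_dir_neg t.i
  have hj := hθ.im_dir_neg t.j
  simp only [Complex.add_im, Complex.im_ofReal_mul, Set.mem_Icc, bot]
  exact ⟨by nlinarith, by nlinarith⟩

theorem bot_lt_top (hθ : IsAdmissible θ) (t : Tile n) : t.bot θ < t.top.im := by
  unfold bot
  linarith [hθ.im_dir_neg t.i, hθ.im_dir_neg t.j]

/-- Tiles are compared by the diagonals from top to bottom vertex. Diagonals of tiles with disjoint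
interiors do not meet at heights interior to both, so by the intermediate value theorem their order
is the same at all common heights. -/
theorem exists_leftmost_tile (hθ : IsAdmissible θ) {R : Finset (Tile n)} (hR : R.Nonempty)
    (hd : ∀ s ∈ R, ∀ t ∈ R, s ≠ t →
      Disjoint (interior (s.carrier θ)) (interior (t.carrier θ))) :
    ∃ t ∈ R, ∀ s ∈ R, s ≠ t → ∀ y, y ∈ Set.Ioo (s.bot θ) s.top.im →
      y ∈ Set.Ioo (t.bot θ) t.top.im → (t.diag θ y).re < (s.diag θ y).re := by
  classical
  have hne : ∀ s ∈ R, ∀ t ∈ R, s ≠ t → ∀ y, y ∈ Set.Ioo (s.bot θ) s.top.im →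
      y ∈ Set.Ioo (t.bot θ) t.top.im → (s.diag θ y).re ≠ (t.diag θ y).re := by
    intro s hs t ht hst y hys hyt he
    have : s.diag θ y = t.diag θ y := Complex.ext he (by rw [im_diag hθ, im_diag hθ])
    refine notMem_of_mem_interior hθ (hd s hs t ht hst) (diag_mem_interior hθ s hys) ?_
    rw [this]
    exact interior_subset (diag_mem_interior hθ t hyt)
  refine exists_leftmost (fun t => t.bot θ) (fun t => t.top.im) (fun t y => (t.diag θ y).re) R hR
    (fun t _ => bot_lt_top hθ t) ?_ hne
  intro s hs t ht hst y y' hys hyt hys' hyt' hlt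
  by_contra hge
  have hI : IsPreconnected (Set.Ioo (s.bot θ) s.top.im ∩ Set.Ioo (t.bot θ) t.top.im) := by
    rw [Set.Ioo_inter_Ioo]; exact isPreconnected_Ioo
  have := hI.intermediate_value ⟨hys, hyt⟩ ⟨hys', hyt'⟩
    (f := fun y => (s.diag θ y).re - (t.diag θ y).re)
    ((continuous_diag θ s).sub (continuous_diag θ t)).continuousOn
  obtain ⟨w, ⟨hws, hwt⟩, hw⟩ := this (show (0 : ℝ) ∈ _ from
    ⟨sub_nonpos.2 hlt.le, sub_nonneg.2 (not_lt.1 hge)⟩)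
  exact hne s hs t ht hst w hws hwt (sub_eq_zero.1 hw)

/-! ### Sweeping a tiling by paths -/

/-- A segment parallel to `dir θ x` all but finitely many points of which are on the path `σ` is
the edge of the path labeled `x`. -/
theorem start_eq_of_generic (hθ : IsAdmissible θ) {σ : Equiv.Perm (Fin n)} {x : Fin n} {p : ℂ}
    {F : Set ℝ} (hF : F.Finite)
    (h : ∀ a ∈ Set.Ioo (0 : ℝ) 1, a ∉ F → ∃ m, ∃ s ∈ Set.Icc (0 : ℝ) 1,
      p + a * dir θ x = start θ σ m + s * dir θ m) : start θ σ x = p := by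
  -- Parameters at which the segment meets the line of an edge with another label: at most one for
  -- each such label.
  let F' : Set ℝ := ⋃ m : Fin n, {a | m ≠ x ∧ ∃ s : ℝ,
    p + a * dir θ x = start θ σ m + s * dir θ m}
  have hF' : F'.Finite := by
    refine Set.finite_iUnion fun m => Set.Subsingleton.finite ?_
    rintro a ⟨hm, s, e⟩ a' ⟨-, s', e'⟩
    by_contra hne
    have e2 : ((a - a' : ℝ) : ℂ) * dir θ x = ((s - s' : ℝ) : ℂ) * dir θ m := by
      push_cast
      linear_combination e - e'
    have e3 : cross (dir θ m) (((a - a' : ℝ) : ℂ) * dir θ x) = 0 := by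
      rw [e2, cross_mul_right, cross_self, mul_zero]
    rw [cross_mul_right] at e3
    exact hm (hθ.eq_of_cross_eq_zero ((mul_eq_zero.1 e3).resolve_left (sub_ne_zero.2 hne)))
  have good : ∀ a ∈ Set.Ioo (0 : ℝ) 1, a ∉ F ∪ F' → ∃ s ∈ Set.Icc (0 : ℝ) 1,
      p.im + a * (dir θ x).im = (start θ σ x).im + s * (dir θ x).im ∧
      p + a * dir θ x = start θ σ x + s * dir θ x := by
    intro a ha hF
    obtain ⟨m, s, hs, e⟩ := h a ha fun h => hF (Or.inl h)
    have hmx : m = x := by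
      by_contra hne
      exact hF (Or.inr (Set.mem_iUnion.2 ⟨m, hne, s, e⟩))
    subst hmx
    refine ⟨s, hs, ?_, e⟩
    simpa using congrArg Complex.im e
  have pick : ∀ u v : ℝ, u < v → ∃ a ∈ Set.Ioo u v, a ∉ F ∪ F' := fun u v huv => by
    obtain ⟨a, ha, ha'⟩ := ((Set.Ioo_infinite huv).sdiff (hF.union hF')).nonempty
    exact ⟨a, ha, ha'⟩
  have hx := hθ.im_dir_neg x
  obtain ⟨a, ha, haF⟩ := pick 0 1 one_pos
  obtain ⟨s, hs, e1, e2⟩ := good a ha haF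
  have him : (start θ σ x).im - p.im = (a - s) * (dir θ x).im := by linarith
  -- The shift between the parameters on the two parallel segments is constant. A nonzero shift
  -- would push a generic point near one end off the edge.
  have hδ : a = s := by
    rcases lt_trichotomy a s with hlt | heq | hlt
    · obtain ⟨a', ha', haF'⟩ := pick (max 0 (1 - (s - a))) 1 (max_lt one_pos (by linarith))
      obtain ⟨h1, h2⟩ := max_lt_iff.1 ha'.1
      obtain ⟨s', hs', e1', -⟩ := good a' ⟨h1, ha'.2⟩ haF'
      have : (a' + (s - a) - s') * (dir θ x).im = 0 := by linear_combination e1' - e1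
      have := (mul_eq_zero.1 this).resolve_right hx.ne
      linarith [hs'.2]
    · exact heq
    · obtain ⟨a', ha', haF'⟩ := pick 0 (min 1 (a - s)) (lt_min one_pos (by linarith))
      obtain ⟨h1, h2⟩ := lt_min_iff.1 ha'.2
      obtain ⟨s', hs', e1', -⟩ := good a' ⟨ha'.1, h1⟩ haF'
      have : (a' + (s - a) - s') * (dir θ x).im = 0 := by linear_combination e1' - e1
      have := (mul_eq_zero.1 this).resolve_right hx.ne
      linarith [hs'.1]
  rw [hδ] at e2
  exact (add_right_cancel e2).symm

section sweep

variable {T R : Finset (Tile n)} {σ : Equiv.Perm (Fin n)} {t : Tile n}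

theorem carrier_subset_polygon (hT : IsRhombicTiling θ T) (ht : t ∈ T) :
    t.carrier θ ⊆ polygon θ := by
  rw [← hT.cover]
  exact Set.subset_biUnion_of_mem (u := fun t : Tile n => t.carrier θ) ht

/-- Points of generic height on the left boundary of the leftmost tile are on the path. -/
theorem leftOf_of_leftmost (hθ : IsAdmissible θ) (hT : IsRhombicTiling θ T) (hRT : R ⊆ T)
    (hL : ∀ u ∈ T, u ∉ R → ∀ z ∈ u.carrier θ, LeftOf θ σ z) (ht : t ∈ R)
    (hmin : ∀ s ∈ R, s ≠ t → ∀ y, y ∈ Set.Ioo (s.bot θ) s.top.im →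
      y ∈ Set.Ioo (t.bot θ) t.top.im → (t.diag θ y).re < (s.diag θ y).re)
    {z : ℂ} (hz : z ∈ t.carrier θ) (hzl : ∀ w ∈ t.carrier θ, w.im = z.im → z.re ≤ w.re)
    (hgen : ∀ u ∈ T, z.im ≠ u.bot θ ∧ z.im ≠ u.top.im) : LeftOf θ σ z := by
  intro m hm
  by_contra hpos
  obtain ⟨s, hs, e1, e2⟩ := hθ.exists_on_edge hm
  set q := start θ σ m + s * dir θ m with hq
  have hd := hθ.im_dir_neg m
  have hqz : q.re < z.re := by
    by_contra hle
    rw [e2] at hpos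
    exact hpos (mul_nonpos_of_nonneg_of_nonpos (by linarith) (by linarith))
  have hqP : q ∈ polygon θ := hθ.edge_mem_polygon σ m hs
  have hzP : z ∈ polygon θ := carrier_subset_polygon hT (hRT ht) hz
  -- A point strictly between the path and `t`. The tile `u` that covers it is not left of the path,
  -- hence in `R`, and its diagonal is to the right of that of `t`. By convexity `u` then contains
  -- the diagonal point of `t` at this height, so the two tiles overlap.
  set z0 : ℂ := ⟨(q.re + z.re) / 2, z.im⟩ with hz0
  have r1 : q.re < z0.re := by simp only [hz0]; linarith
  have r2 : z0.re < z.re := by simp only [hz0]; linarith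
  have hz0P : z0 ∈ polygon θ :=
    mem_of_convex_of_im_eq (convex_polygon θ) hqP hzP e1 rfl r1.le r2.le
  rw [← hT.cover] at hz0P
  obtain ⟨u, huT, hu⟩ := Set.mem_iUnion₂.1 hz0P
  have huR : u ∈ R := by
    by_contra huR
    have := hL u huT huR z0 hu m hm
    rw [show z0 - start θ σ m = (z - start θ σ m) - (z - z0) by ring, cross_sub_right, e2,
      cross_of_im_eq (show z.im = z0.im from rfl)] at this
    nlinarith
  have hut : u ≠ t := by
    rintro rfl
    exact absurd (hzl z0 hu rfl) (not_le.2 r2)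
  have genIoo : ∀ v ∈ T, ∀ w ∈ v.carrier θ, w.im = z.im →
      z.im ∈ Set.Ioo (v.bot θ) v.top.im := by
    intro v hv w hw hwz
    have := im_mem_Icc_of_mem_carrier hθ v hw
    rw [hwz] at this
    exact ⟨lt_of_le_of_ne this.1 (hgen v hv).1.symm, lt_of_le_of_ne this.2 (hgen v hv).2⟩
  have hyu := genIoo u huT z0 hu rfl
  have hyt := genIoo t (hRT ht) z hz rfl
  have hlt := hmin u huR hut z.im hyu hyt
  have hdt := diag_mem_interior hθ t hyt
  have hdu := diag_mem_interior hθ u hyu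
  have hle := hzl _ (interior_subset hdt) (im_diag hθ t _)
  refine notMem_of_mem_interior hθ (hT.disjoint_interior t (hRT ht) u huT hut.symm) hdt ?_
  exact mem_of_convex_of_im_eq (convex_carrier θ u) hu (interior_subset hdu)
    (im_diag hθ t _).symm (by rw [im_diag hθ, im_diag hθ]) (r2.le.trans hle) hlt.le

/-- The leftmost tile to the right of the path sits at two consecutive edges of the path. -/
theorem leftmost_on_path (hθ : IsAdmissible θ) (hT : IsRhombicTiling θ T) (hRT : R ⊆ T)
    (hL : ∀ u ∈ T, u ∉ R → ∀ z ∈ u.carrier θ, LeftOf θ σ z)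
    (hR : ∀ u ∈ R, ∀ z ∈ u.carrier θ, RightOf θ σ z) (ht : t ∈ R)
    (hmin : ∀ s ∈ R, s ≠ t → ∀ y, y ∈ Set.Ioo (s.bot θ) s.top.im →
      y ∈ Set.Ioo (t.bot θ) t.top.im → (t.diag θ y).re < (s.diag θ y).re) :
    start θ σ t.i = t.top ∧ start θ σ t.j = t.top + dir θ t.i := by
  have hD := hθ.cross_pos t.lt
  -- The leftmost property is available only at heights strictly inside tiles, so the finitely many
  -- heights of top and bottom vertices are avoided.
  let H : Set ℝ := ⋃ u ∈ T, {u.bot θ, u.top.im}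
  have hH : H.Finite := T.finite_toSet.biUnion fun u _ => by simp
  have key : ∀ (x : Fin n) (p : ℂ), (∀ a ∈ Set.Ioo (0 : ℝ) 1, p + a * dir θ x ∈ t.carrier θ ∧
      ∀ w ∈ t.carrier θ, 0 ≤ cross (dir θ x) (w - (p + a * dir θ x))) → start θ σ x = p := by
    intro x p hx
    have hxd := hθ.im_dir_neg x
    have hFin : ((fun a : ℝ => p.im + a * (dir θ x).im) ⁻¹' H).Finite := by
      refine hH.preimage fun a _ b _ hab => ?_
      have : (a - b) * (dir θ x).im = 0 := by
        linarith
      exact sub_eq_zero.1 ((mul_eq_zero.1 this).resolve_right hxd.ne)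
    refine start_eq_of_generic hθ hFin fun a ha haF => ?_
    obtain ⟨hmem, hleft⟩ := hx a ha
    have hpol := hθ.halfPlane_of_mem_polygon (carrier_subset_polygon hT (hRT ht) hmem)
    refine (hR t ht _ hmem).exists_on_edge hθ x.pos ?_ hpol.1 hpol.2.1
    refine leftOf_of_leftmost hθ hT hRT hL ht hmin hmem (fun w hw him => ?_) fun u hu => ?_
    · have := hleft w hw
      rw [cross_of_im_eq him] at this
      nlinarith
    · have hnot : (p + a * dir θ x).im ∉ H := by
        rw [Complex.add_im, Complex.im_ofReal_mul]; exact haF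
      constructor
      · intro he
        exact hnot (Set.mem_biUnion hu (by simp [he]))
      · intro he
        exact hnot (Set.mem_biUnion hu (by simp [he]))
  constructor
  · refine key _ _ fun a ha => ⟨⟨a, Set.Ioo_subset_Icc_self ha, 0, by simp, by simp⟩, ?_⟩
    rintro w ⟨a', ha', b', hb', rfl⟩
    rw [show t.top + a' * dir θ t.i + b' * dir θ t.j - (t.top + a * dir θ t.i)
      = ((a' - a : ℝ) : ℂ) * dir θ t.i + b' * dir θ t.j by push_cast; ring, cross_add_right,
      cross_mul_right, cross_mul_right, cross_self, mul_zero, zero_add]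
    exact mul_nonneg hb'.1 hD.le
  · refine key _ _ fun b hb => ⟨⟨1, by simp, b, Set.Ioo_subset_Icc_self hb, by simp⟩, ?_⟩
    rintro w ⟨a', ha', b', hb', rfl⟩
    rw [show t.top + a' * dir θ t.i + b' * dir θ t.j - (t.top + dir θ t.i + b * dir θ t.j)
      = ((a' - 1 : ℝ) : ℂ) * dir θ t.i + ((b' - b : ℝ) : ℂ) * dir θ t.j by push_cast; ring,
      cross_add_right, cross_mul_right, cross_mul_right, cross_self, mul_zero, add_zero,
      cross_swap]
    nlinarith [ha'.2]

/-- The tiles right of a path have labels in the order of the path, and each pair occurs once. -/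
theorem sweep (hθ : IsAdmissible θ) (hT : IsRhombicTiling θ T) :
    ∀ (R : Finset (Tile n)) (σ : Equiv.Perm (Fin n)), R ⊆ T →
      (∀ u ∈ T, u ∉ R → ∀ z ∈ u.carrier θ, LeftOf θ σ z) →
      (∀ u ∈ R, ∀ z ∈ u.carrier θ, RightOf θ σ z) →
      (∀ u ∈ R, σ u.i < σ u.j) ∧ ∀ u ∈ R, ∀ v ∈ R, u.i = v.i → u.j = v.j → u = v := by
  classical
  intro R
  induction R using Finset.strongInduction with
  | H R ih =>
  intro σ hRT hL hR
  rcases R.eq_empty_or_nonempty with rfl | hne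
  · simp
  obtain ⟨t, ht, hmin⟩ := exists_leftmost_tile hθ hne fun s hs u hu hsu =>
    hT.disjoint_interior s (hRT hs) u (hRT hu) hsu
  obtain ⟨hi, hj⟩ := leftmost_on_path hθ hT hRT hL hR ht hmin
  have hadj : (σ t.j : ℕ) = σ t.i + 1 := hθ.next_of_start (by rw [hi, hj])
  have coords : ∀ z, z = start θ σ t.i + coordI θ t.i t.j (z - t.top) * dir θ t.i
      + coordJ θ t.i t.j (z - t.top) * dir θ t.j := fun z => by
    rw [add_assoc, ← eq_coord hθ t.lt, hi]; ring
  have hE := ih (R.erase t) (Finset.erase_ssubset ht) (σ * Equiv.swap t.i t.j)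
    ((Finset.erase_subset _ _).trans hRT) ?_ ?_
  · obtain ⟨h1, h2⟩ := hE
    have hnot : ∀ u ∈ R, u ≠ t → ¬(u.i = t.i ∧ u.j = t.j) := by
      rintro u hu hut ⟨e1, e2⟩
      have := h1 u (Finset.mem_erase.2 ⟨hut, hu⟩)
      rw [e1, e2, Fin.lt_def, swap_next hadj] at this
      omega
    constructor
    · intro u hu
      by_cases hut : u = t
      · rw [hut, Fin.lt_def, hadj]; omega
      · refine (swap_lt_iff hadj (hnot u hu hut) ?_).1 (h1 u (Finset.mem_erase.2 ⟨hut, hu⟩))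
        rintro ⟨e1, e2⟩
        have := u.lt
        rw [e1, e2] at this
        exact lt_asymm this t.lt
    · intro u hu v hv e1 e2
      by_cases hut : u = t
      · by_contra hne
        exact hnot v hv (fun h => hne (hut.trans h.symm)) ⟨by rw [← e1, hut], by rw [← e2, hut]⟩
      by_cases hvt : v = t
      · exact absurd ⟨by rw [e1, hvt], by rw [e2, hvt]⟩ (hnot u hu hut)
      exact h2 u (Finset.mem_erase.2 ⟨hut, hu⟩) v (Finset.mem_erase.2 ⟨hvt, hv⟩) e1 e2
  · intro u hu huE z hz
    by_cases hut : u = t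
    · subst hut
      have hc := (mem_carrier_iff hθ u z).1 hz
      exact leftOf_swap_of_coord hθ u.lt hadj hc.1 hc.2 (coords z)
    · exact (hL u hu (fun h => huE (Finset.mem_erase.2 ⟨hut, h⟩)) z hz).swap hθ t.lt hadj
  · intro u hu z hz
    by_contra hnr
    have huR := Finset.mem_of_mem_erase hu
    have hut := Finset.ne_of_mem_erase hu
    obtain ⟨k1, k2, k3, k4⟩ :=
      (hR u huR z hz).coord_bounds_of_not_swap hθ t.lt hadj (coords z) hnr
    -- The bounds that hold strictly at `z` persist nearby, hence at an interior point `w` of `u`.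
    -- The remaining bounds hold since `w` is right of the old path, so `w` lies in `t`, a
    -- contradiction.
    have hopen : IsOpen {w : ℂ | (w.im < (start θ σ t.i).im ∧
        (start θ σ t.i).im + (dir θ t.i).im + (dir θ t.j).im < w.im) ∧
        0 < coordI θ t.i t.j (w - t.top) ∧ coordJ θ t.i t.j (w - t.top) < 1} := by
      have c1 : Continuous fun w : ℂ => coordI θ t.i t.j (w - t.top) :=
        (continuous_coordI θ _ _).comp (by fun_prop)
      have c2 : Continuous fun w : ℂ => coordJ θ t.i t.j (w - t.top) :=
        (continuous_coordJ θ _ _).comp (by fun_prop)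
      exact ((isOpen_lt Complex.continuous_im continuous_const).inter
        (isOpen_lt continuous_const Complex.continuous_im)).inter
        ((isOpen_lt continuous_const c1).inter (isOpen_lt c2 continuous_const))
    obtain ⟨w, ⟨⟨w1, w2⟩, w3, w4⟩, hw⟩ := mem_closure_iff.1
      (subset_closure_interior_carrier hθ u hz) _ hopen ⟨⟨k1, k2⟩, k3.1, k4.2⟩
    obtain ⟨w5, w6⟩ := (hR u huR w (interior_subset hw)).coord_bounds hθ t.lt hadj (coords w)
      w1.le w2.le
    exact notMem_of_mem_interior hθ (hT.disjoint_interior u (hRT huR) t (hRT ht) hut) hw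
      ((mem_carrier_iff hθ t w).2 ⟨⟨w3.le, w5⟩, ⟨w6, w4.le⟩⟩)

/-- A rhombic tiling has at most one tile with a given pair of labels. -/
theorem tile_eq_of_labels (hθ : IsAdmissible θ) (hT : IsRhombicTiling θ T) {s t : Tile n}
    (hs : s ∈ T) (ht : t ∈ T) (hi : s.i = t.i) (hj : s.j = t.j) : s = t :=
  (sweep hθ hT T 1 subset_rfl (fun _ hu hu' => absurd hu hu') fun _ hu _ hz =>
    hθ.rightOf_of_mem_polygon (carrier_subset_polygon hT hu hz)).2 s hs t ht hi hj

end sweep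

/-! ### Tile edges on the boundary and the types of perimeter tiles -/

namespace Tile

/-- The upper endpoints of the edges of a tile. -/
noncomputable def edgeStart (θ : Fin n → ℝ) (t : Tile n) : Fin 4 → ℂ :=
  ![t.top, t.top + dir θ t.i, t.top + dir θ t.j, t.top]

/-- The labels of the edges of a tile. -/
def edgeLabel (t : Tile n) : Fin 4 → Fin n := ![t.i, t.j, t.i, t.j]

theorem edge_eq (θ : Fin n → ℝ) (t : Tile n) (k : Fin 4) :
    t.edge θ k = segment ℝ (t.edgeStart θ k) (t.edgeStart θ k + dir θ (t.edgeLabel k)) := by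
  fin_cases k
  · rfl
  · rfl
  · change segment ℝ (t.top + dir θ t.i + dir θ t.j) (t.top + dir θ t.j) = _
    rw [segment_symm, add_right_comm]
    rfl
  · change segment ℝ (t.top + dir θ t.j) t.top = _
    rw [segment_symm]
    rfl

end Tile

theorem mem_segment_add_iff {p u z : ℂ} :
    z ∈ segment ℝ p (p + u) ↔ ∃ a ∈ Set.Icc (0 : ℝ) 1, z = p + a * u := by
  rw [segment_eq_image']
  simp only [add_sub_cancel_left, Set.mem_image, Complex.real_smul]
  exact ⟨fun ⟨a, ha, e⟩ => ⟨a, ha, e.symm⟩, fun ⟨a, ha, e⟩ => ⟨a, ha, e.symm⟩⟩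

/-- Edges with more than one common point are parallel and on one line. -/
theorem label_eq_of_nontrivial_inter (hθ : IsAdmissible θ) {p p' : ℂ} {m m' : Fin n}
    (h : (segment ℝ p (p + dir θ m) ∩ segment ℝ p' (p' + dir θ m')).Nontrivial) :
    m = m' ∧ cross (dir θ m) p = cross (dir θ m) p' := by
  obtain ⟨z, ⟨hz, hz'⟩, w, ⟨hw, hw'⟩, hne⟩ := h
  obtain ⟨a, -, ea⟩ := mem_segment_add_iff.1 hz
  obtain ⟨a', -, ea'⟩ := mem_segment_add_iff.1 hz'
  obtain ⟨b, -, eb⟩ := mem_segment_add_iff.1 hw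
  obtain ⟨b', -, eb'⟩ := mem_segment_add_iff.1 hw'
  have hab : a' ≠ b' := fun e => hne (by rw [ea', eb', e])
  have e1 : ((a' - b' : ℝ) : ℂ) * dir θ m' = ((a - b : ℝ) : ℂ) * dir θ m := by
    push_cast
    linear_combination ea - ea' - eb + eb'
  have e2 : cross (dir θ m) (((a' - b' : ℝ) : ℂ) * dir θ m') = 0 := by
    rw [e1, cross_mul_right, cross_self, mul_zero]
  rw [cross_mul_right] at e2
  have hm := hθ.eq_of_cross_eq_zero ((mul_eq_zero.1 e2).resolve_left (sub_ne_zero.2 hab))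
  subst hm
  refine ⟨rfl, ?_⟩
  have e3 := ea.symm.trans ea'
  have := congrArg (cross (dir θ m)) e3
  simpa [cross_add_right, cross_mul_right, cross_self] using this

/-- All directions point strictly down, so the upper endpoint and the label can be read off from the
segment. -/
theorem edge_eq_iff (hθ : IsAdmissible θ) {p p' : ℂ} {m m' : Fin n} :
    segment ℝ p (p + dir θ m) = segment ℝ p' (p' + dir θ m') ↔ p = p' ∧ m = m' := by
  refine ⟨fun h => ?_, fun ⟨h1, h2⟩ => by rw [h1, h2]⟩
  have hne : p ≠ p + dir θ m := fun e => by
    have := congrArg Complex.im e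
    rw [Complex.add_im] at this
    linarith [hθ.im_dir_neg m]
  have hmm : m = m' := by
    refine (label_eq_of_nontrivial_inter hθ (p := p) (p' := p') ?_).1
    rw [← h, Set.inter_self]
    exact ⟨p, left_mem_segment ℝ _ _, _, right_mem_segment ℝ _ _, hne⟩
  subst hmm
  obtain ⟨a, ha, ea⟩ := mem_segment_add_iff.1 (h ▸ left_mem_segment ℝ p (p + dir θ m))
  obtain ⟨b, hb, eb⟩ := mem_segment_add_iff.1 (h.symm ▸ left_mem_segment ℝ p' (p' + dir θ m))
  have hm := hθ.im_dir_neg m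
  have : (a + b) * (dir θ m).im = 0 := by
    have e1 := congrArg Complex.im ea
    have e2 := congrArg Complex.im eb
    simp only [Complex.add_im, Complex.im_ofReal_mul] at e1 e2
    linarith
  have h0 := (mul_eq_zero.1 this).resolve_right hm.ne
  have ha0 : a = 0 := by linarith [ha.1, hb.1]
  refine ⟨?_, rfl⟩
  rw [ea, ha0]; simp

theorem edge_mem_leftSides_iff (hθ : IsAdmissible θ) (t : Tile n) (k : Fin 4) :
    t.edge θ k ∈ leftSides θ ↔ t.edgeStart θ k = start θ 1 (t.edgeLabel k) := by
  rw [mem_leftSides_iff, Tile.edge_eq]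
  constructor
  · rintro ⟨m, h⟩
    obtain ⟨h1, h2⟩ := (edge_eq_iff hθ).1 h
    rw [h1, h2]
  · intro h
    exact ⟨_, by rw [h]⟩

theorem edge_mem_rightSides_iff (hθ : IsAdmissible θ) (t : Tile n) (k : Fin 4) :
    t.edge θ k ∈ rightSides θ ↔ t.edgeStart θ k = start θ Fin.revPerm (t.edgeLabel k) := by
  rw [mem_rightSides_iff, Tile.edge_eq]
  constructor
  · rintro ⟨m, h⟩
    obtain ⟨h1, h2⟩ := (edge_eq_iff hθ).1 h
    rw [h1, h2]
  · intro h
    exact ⟨_, by rw [h]⟩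

theorem edge_mem_sides_iff (hθ : IsAdmissible θ) (t : Tile n) (k : Fin 4) :
    t.edge θ k ∈ sides θ ↔ t.edgeStart θ k = start θ 1 (t.edgeLabel k) ∨
      t.edgeStart θ k = start θ Fin.revPerm (t.edgeLabel k) := by
  rw [sides, Set.mem_union, edge_mem_leftSides_iff hθ, edge_mem_rightSides_iff hθ]

theorem start_injective (hθ : IsAdmissible θ) (σ : Equiv.Perm (Fin n)) {i j : Fin n}
    (h : start θ σ i = start θ σ j) : i = j := by
  rcases lt_trichotomy (σ i) (σ j) with h1 | h1 | h1
  · exact absurd (hθ.im_start_lt h1) (by rw [h]; exact lt_irrefl _)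
  · exact σ.injective h1
  · exact absurd (hθ.im_start_lt h1) (by rw [h]; exact lt_irrefl _)

theorem start_add_dir_injective (hθ : IsAdmissible θ) (σ : Equiv.Perm (Fin n)) {i j : Fin n}
    (h : start θ σ i + dir θ i = start θ σ j + dir θ j) : i = j := by
  have aux : ∀ i j, start θ σ i + dir θ i = start θ σ j + dir θ j → ¬ σ i < σ j := by
    intro i j h h1
    have := hθ.im_start_le h1
    rw [h, Complex.add_im] at this
    linarith [hθ.im_dir_neg j]
  rcases lt_trichotomy (σ i) (σ j) with h1 | h1 | h1
  · exact absurd h1 (aux _ _ h)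
  · exact σ.injective h1
  · exact absurd h1 (aux _ _ h.symm)

theorem dir_ne_zero (hθ : IsAdmissible θ) (i : Fin n) : dir θ i ≠ 0 := fun h => by
  have := hθ.im_dir_neg i
  rw [h] at this
  simp at this

/-- Two edges of a tile on one path have consecutive positions. -/
theorem next_of_two_edges (hθ : IsAdmissible θ) (σ : Equiv.Perm (Fin n)) (t : Tile n)
    {k l : Fin 4} (hkl : k ≠ l) (hk : t.edgeStart θ k = start θ σ (t.edgeLabel k))
    (hl : t.edgeStart θ l = start θ σ (t.edgeLabel l)) :
    (σ t.j : ℕ) = σ t.i + 1 ∨ (σ t.i : ℕ) = σ t.j + 1 := by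
  have h01 : t.top = start θ σ t.i → t.top + dir θ t.i = start θ σ t.j →
      (σ t.j : ℕ) = σ t.i + 1 ∨ (σ t.i : ℕ) = σ t.j + 1 := fun e0 e1 =>
    Or.inl (hθ.next_of_start (by rw [← e1, e0]))
  have h32 : t.top = start θ σ t.j → t.top + dir θ t.j = start θ σ t.i →
      (σ t.j : ℕ) = σ t.i + 1 ∨ (σ t.i : ℕ) = σ t.j + 1 := fun e0 e1 =>
    Or.inr (hθ.next_of_start (by rw [← e1, e0]))
  have h02 : t.top = start θ σ t.i → t.top + dir θ t.j = start θ σ t.i → False := fun e0 e1 =>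
    dir_ne_zero hθ t.j (by linear_combination e1 - e0)
  have h13 : t.top + dir θ t.i = start θ σ t.j → t.top = start θ σ t.j → False := fun e0 e1 =>
    dir_ne_zero hθ t.i (by linear_combination e0 - e1)
  have h03 : t.top = start θ σ t.i → t.top = start θ σ t.j → False := fun e0 e1 =>
    t.lt.ne (start_injective hθ σ (e0.symm.trans e1))
  have h12 : t.top + dir θ t.i = start θ σ t.j → t.top + dir θ t.j = start θ σ t.i → False :=
    fun e0 e1 => t.lt.ne (start_add_dir_injective hθ σ (by linear_combination e0 - e1))
  fin_cases k <;> fin_cases l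
  · exact absurd rfl hkl
  · exact h01 hk hl
  · exact (h02 hk hl).elim
  · exact (h03 hk hl).elim
  · exact h01 hl hk
  · exact absurd rfl hkl
  · exact (h12 hk hl).elim
  · exact (h13 hk hl).elim
  · exact (h02 hl hk).elim
  · exact (h12 hl hk).elim
  · exact absurd rfl hkl
  · exact h32 hl hk
  · exact (h03 hl hk).elim
  · exact (h13 hl hk).elim
  · exact h32 hk hl
  · exact absurd rfl hkl

theorem next_of_sidePerimeter (hθ : IsAdmissible θ) {t : Tile n} (h : t.IsSidePerimeter θ) :
    (t.j : ℕ) = t.i + 1 := by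
  have hlt := Fin.lt_def.1 t.lt
  rcases h with ⟨-, k, l, hkl, hk, hl⟩ | ⟨-, k, l, hkl, hk, hl⟩
  · have := next_of_two_edges hθ 1 t hkl ((edge_mem_leftSides_iff hθ t k).1 hk)
      ((edge_mem_leftSides_iff hθ t l).1 hl)
    simp only [Equiv.Perm.one_apply] at this
    omega
  · have := next_of_two_edges hθ Fin.revPerm t hkl ((edge_mem_rightSides_iff hθ t k).1 hk)
      ((edge_mem_rightSides_iff hθ t l).1 hl)
    simp only [Fin.revPerm_apply, Fin.val_rev] at this
    omega

/-- The tile has two consecutive edges on the leftside boundary. -/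
def LeftCorner (θ : Fin n → ℝ) (t : Tile n) : Prop :=
  (t.j : ℕ) = t.i + 1 ∧ t.top = start θ 1 t.i ∧ t.top + dir θ t.i = start θ 1 t.j

/-- The tile has two consecutive edges on the rightside boundary. -/
def RightCorner (θ : Fin n → ℝ) (t : Tile n) : Prop :=
  (t.j : ℕ) = t.i + 1 ∧ t.top = start θ Fin.revPerm t.j ∧
    t.top + dir θ t.j = start θ Fin.revPerm t.i

/-- The tile fills the topmost corner of the polygon. -/
def TopCorner (θ : Fin n → ℝ) (t : Tile n) : Prop :=
  (t.i : ℕ) = 0 ∧ (t.j : ℕ) + 1 = n ∧ t.top = start θ 1 t.i ∧ t.top = start θ Fin.revPerm t.j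

/-- The tile fills the bottommost corner of the polygon. -/
def BottomCorner (θ : Fin n → ℝ) (t : Tile n) : Prop :=
  (t.i : ℕ) = 0 ∧ (t.j : ℕ) + 1 = n ∧ t.top + dir θ t.i = start θ 1 t.j ∧
    t.top + dir θ t.j = start θ Fin.revPerm t.i

/-- Two consecutive edges on one boundary path either have consecutive labels or are incompatible.
For edges on different boundaries, writing their common vertex in two ways equates two sums of
directions, and `eq_of_sum_eq` equates the index sets. An initial and a final segment of labels
coincide only if both are empty (top corner) or both are everything (bottom corner); the other mixed
cases are contradictory. -/
theorem perimeter_cases (hθ : IsAdmissible θ) {t : Tile n} (h : t.IsPerimeter θ) :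
    LeftCorner θ t ∨ RightCorner θ t ∨ TopCorner θ t ∨ BottomCorner θ t := by
  obtain ⟨p, i, j, lt⟩ := t
  have n0 := i.pos
  have hlt := Fin.lt_def.1 lt
  have Ls : ∀ m : Fin n, start θ 1 m = ∑ x with x < m, dir θ x := fun _ => rfl
  have Ls' : ∀ m : Fin n, start θ 1 m + dir θ m = ∑ x with x ≤ m, dir θ x := start_add_dir θ 1
  have Rs : ∀ m : Fin n, start θ Fin.revPerm m = ∑ x with m < x, dir θ x := fun m => by
    unfold start
    refine Finset.sum_congr (Finset.filter_congr fun x _ => ?_) fun _ _ => rfl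
    simp
  have Rs' : ∀ m : Fin n, start θ Fin.revPerm m + dir θ m = ∑ x with m ≤ x, dir θ x := fun m => by
    rw [start_add_dir]
    refine Finset.sum_congr (Finset.filter_congr fun x _ => ?_) fun _ _ => rfl
    simp
  have key : ∀ (p q : Fin n → Prop) [DecidablePred p] [DecidablePred q],
      ∑ x with p x, dir θ x = ∑ x with q x, dir θ x →
      (∀ x y, p x → ¬ q x → q y → ¬ p y → x < y) → ∀ x, p x ↔ q x := by
    intro p q _ _ hs hpq x
    have := hθ.eq_of_sum_eq (A := Finset.univ.filter p) (B := Finset.univ.filter q)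
      (fun x hx y hy => by
        simp only [Finset.mem_sdiff, Finset.mem_filter, Finset.mem_univ, true_and] at hx hy
        exact hpq x y hx.1 hx.2 hy.1 hy.2) hs
    have := Finset.ext_iff.1 this x
    simpa using this
  obtain ⟨k, h1, h2⟩ := h
  rw [edge_mem_sides_iff hθ] at h1 h2
  fin_cases k
  · change p = start θ 1 i ∨ p = start θ Fin.revPerm i at h1
    change p + dir θ i = start θ 1 j ∨ p + dir θ i = start θ Fin.revPerm j at h2
    rcases h1 with h1 | h1 <;> rcases h2 with h2 | h2
    · exact Or.inl ⟨hθ.next_of_start (σ := 1) (by rw [← h1, h2]), h1, h2⟩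
    · rw [h1, Ls', Rs] at h2
      have := (key _ _ h2 (fun x y hx _ hy _ => hx.trans_lt (lt.trans hy)) i).1 le_rfl
      exact absurd this lt.not_gt
    · rw [h1, Ls, Rs'] at h2
      have := (key _ _ h2.symm (fun x y hx hx' hy hy' =>
        (not_le.1 hx').trans_le (lt.le.trans (not_lt.1 hy'))) j).2 lt.le
      exact absurd this (lt_irrefl _)
    · have := hθ.next_of_start (σ := Fin.revPerm) (i := i) (j := j) (by rw [← h1, h2])
      simp only [Fin.revPerm_apply, Fin.val_rev] at this
      omega
  · change p + dir θ i = start θ 1 j ∨ p + dir θ i = start θ Fin.revPerm j at h1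
    change (p + dir θ j = start θ 1 i ∨ p + dir θ j = start θ Fin.revPerm i) at h2
    rcases h1 with h1 | h1 <;> rcases h2 with h2 | h2
    · exact absurd (start_add_dir_injective hθ 1 (i := i) (j := j)
        (by rw [← h1, ← h2]; ring)) lt.ne
    · have e : start θ 1 j + dir θ j = start θ Fin.revPerm i + dir θ i := by
        rw [← h1, ← h2]; ring
      rw [Ls', Rs'] at e
      have h := key _ _ e fun x y hx hx' hy hy' => (not_le.1 hx').trans (lt.trans (not_le.1 hy'))
      have a1 := Fin.le_def.1 ((h ⟨0, n0⟩).1 (Fin.le_def.2 (Nat.zero_le _)))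
      have a2 := Fin.le_def.1 ((h ⟨n - 1, by omega⟩).2 (Fin.le_def.2 (by simp only; omega)))
      simp only at a1 a2
      exact Or.inr (Or.inr (Or.inr ⟨by simp only; omega, by simp only; omega, h1, h2⟩))
    · have e : start θ 1 i + dir θ i = start θ Fin.revPerm j + dir θ j := by
        rw [← h1, ← h2]; ring
      rw [Ls', Rs'] at e
      have := (key _ _ e (fun x y hx _ hy _ => hx.trans_lt (lt.trans_le hy)) i).1 le_rfl
      exact absurd this lt.not_ge
    · exact absurd (start_add_dir_injective hθ Fin.revPerm (i := i) (j := j)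
        (by rw [← h1, ← h2]; ring)) lt.ne
  · change (p + dir θ j = start θ 1 i ∨ p + dir θ j = start θ Fin.revPerm i) at h1
    change p = start θ 1 j ∨ p = start θ Fin.revPerm j at h2
    rcases h1 with h1 | h1 <;> rcases h2 with h2 | h2
    · have := hθ.next_of_start (σ := 1) (i := j) (j := i) (by rw [← h1, h2])
      simp only [Equiv.Perm.one_apply] at this
      omega
    · rw [h2, Rs', Ls] at h1
      have := (key _ _ h1.symm (fun x y hx _ hy _ => hx.trans (lt.trans_le hy)) j).2 le_rfl
      exact absurd this lt.not_gt
    · rw [h2, Ls', Rs] at h1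
      have := (key _ _ h1 (fun x y hx hx' hy hy' =>
        (not_lt.1 hx').trans_lt (lt.trans (not_le.1 hy'))) i).1 lt.le
      exact absurd this (lt_irrefl _)
    · have := hθ.next_of_start (σ := Fin.revPerm) (i := j) (j := i) (by rw [← h1, h2])
      simp only [Fin.revPerm_apply, Fin.val_rev] at this
      exact Or.inr (Or.inl ⟨by simp only; omega, h2, h1⟩)
  · change p = start θ 1 j ∨ p = start θ Fin.revPerm j at h1
    change p = start θ 1 i ∨ p = start θ Fin.revPerm i at h2
    rcases h1 with h1 | h1 <;> rcases h2 with h2 | h2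
    · exact absurd (start_injective hθ 1 (h2.symm.trans h1)) lt.ne
    · have e := h1.symm.trans h2
      rw [Ls, Rs] at e
      have := (key _ _ e (fun x y hx hx' hy hy' =>
        (not_lt.1 hx').trans_lt (lt.trans_le (not_lt.1 hy'))) i).1 lt
      exact absurd this (lt_irrefl _)
    · have e := h2.symm.trans h1
      rw [Ls, Rs] at e
      have h := key _ _ e fun x y hx _ hy _ => hx.trans (lt.trans hy)
      have a1 : (i : ℕ) = 0 := by
        by_contra h0
        have := Fin.lt_def.1 ((h ⟨0, n0⟩).1 (Fin.lt_def.2 (Nat.pos_of_ne_zero h0)))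
        exact absurd this (Nat.not_lt_zero _)
      have a2 : (j : ℕ) + 1 = n := by
        by_contra h0
        have := Fin.lt_def.1 ((h ⟨n - 1, by omega⟩).2 (Fin.lt_def.2 (by simp only; omega)))
        simp only at this
        omega
      exact Or.inr (Or.inr (Or.inl ⟨a1, a2, h2, h1⟩))
    · exact absurd (start_injective hθ Fin.revPerm (h2.symm.trans h1)) lt.ne

/-! ### Overlaps at a common edge and the upper bounds -/

/-- Parallelograms on the same side of a common edge overlap. -/
theorem exists_common_point {u v v' : ℂ} (h : 0 < cross u v) (h' : 0 < cross u v') :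
    ∃ a ∈ Set.Ioo (0 : ℝ) 1, ∃ b ∈ Set.Ioo (0 : ℝ) 1, ∃ a' ∈ Set.Ioo (0 : ℝ) 1,
      ∃ b' ∈ Set.Ioo (0 : ℝ) 1, (a : ℂ) * u + b * v = a' * u + b' * v' := by
  obtain ⟨α, β, hβ, e⟩ : ∃ α β : ℝ, 0 < β ∧ v = α * u + β * v' := by
    refine ⟨cross v v' / cross u v', cross u v / cross u v', div_pos h h', ?_⟩
    have hD := h'.ne'
    apply Complex.ext
    · rw [Complex.add_re, Complex.re_ofReal_mul, Complex.re_ofReal_mul]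
      field_simp
      simp only [cross]; ring
    · rw [Complex.add_im, Complex.im_ofReal_mul, Complex.im_ofReal_mul]
      field_simp
      simp only [cross]; ring
  have hS : 0 < 2 * (1 + |α| + β) := by positivity
  have hα := abs_nonneg α
  -- A small step along `v` from the midpoint of the edge. The denominator keeps the shift `α / (2 *
  -- (1 + |α| + β))` below `1/2` in absolute value and both transversal coordinates below `1`.
  refine ⟨1 / 2, by norm_num, 1 / (2 * (1 + |α| + β)), ⟨by positivity, ?_⟩,
    1 / 2 + α / (2 * (1 + |α| + β)), ⟨?_, ?_⟩, β / (2 * (1 + |α| + β)), ⟨by positivity, ?_⟩, ?_⟩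
  · rw [div_lt_one hS]; linarith
  · have : -(1 / 2) < α / (2 * (1 + |α| + β)) := by
      rw [lt_div_iff₀ hS]; linarith [neg_abs_le α]
    linarith
  · have : α / (2 * (1 + |α| + β)) < 1 / 2 := by
      rw [div_lt_iff₀ hS]; linarith [le_abs_self α]
    linarith
  · rw [div_lt_one hS]; linarith
  · rw [e]
    push_cast
    ring

/-- `t` lies to the right of its edge from `p` with label `m`. -/
def RightOfEdge (θ : Fin n → ℝ) (t : Tile n) (p : ℂ) (m : Fin n) : Prop :=
  t.i = m ∧ t.top = p ∨ t.j = m ∧ t.top + dir θ t.i = p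

/-- `t` lies to the left of its edge from `p` with label `m`. -/
def LeftOfEdge (θ : Fin n → ℝ) (t : Tile n) (p : ℂ) (m : Fin n) : Prop :=
  t.j = m ∧ t.top = p ∨ t.i = m ∧ t.top + dir θ t.j = p

theorem RightOfEdge.exists_interior (hθ : IsAdmissible θ) {t : Tile n} {p : ℂ} {m : Fin n}
    (h : RightOfEdge θ t p m) : ∃ v, 0 < cross (dir θ m) v ∧ ∀ a ∈ Set.Ioo (0 : ℝ) 1,
      ∀ b ∈ Set.Ioo (0 : ℝ) 1, p + (a * dir θ m + b * v) ∈ interior (t.carrier θ) := by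
  rcases h with ⟨rfl, rfl⟩ | ⟨rfl, rfl⟩
  · refine ⟨dir θ t.j, hθ.cross_pos t.lt, fun a ha b hb => ?_⟩
    rw [← add_assoc]
    exact mem_interior_carrier hθ t ha hb
  · refine ⟨-dir θ t.i, ?_, fun a ha b hb => ?_⟩
    · rw [cross_neg_right, ← cross_swap]; exact hθ.cross_pos t.lt
    · have := mem_interior_carrier hθ t (a := 1 - b) (b := a)
        ⟨by linarith [hb.2], by linarith [hb.1]⟩ ha
      convert this using 1
      push_cast
      ring

theorem LeftOfEdge.exists_interior (hθ : IsAdmissible θ) {t : Tile n} {p : ℂ} {m : Fin n}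
    (h : LeftOfEdge θ t p m) : ∃ v, 0 < cross (dir θ m) v ∧ ∀ a ∈ Set.Ioo (0 : ℝ) 1,
      ∀ b ∈ Set.Ioo (0 : ℝ) 1, p + (a * dir θ m + b * -v) ∈ interior (t.carrier θ) := by
  rcases h with ⟨rfl, rfl⟩ | ⟨rfl, rfl⟩
  · refine ⟨-dir θ t.i, ?_, fun a ha b hb => ?_⟩
    · rw [cross_neg_right, ← cross_swap]; exact hθ.cross_pos t.lt
    · have := mem_interior_carrier hθ t hb ha
      convert this using 1
      ring
  · refine ⟨dir θ t.j, hθ.cross_pos t.lt, fun a ha b hb => ?_⟩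
    have := mem_interior_carrier hθ t (a := a) (b := 1 - b) ha
      ⟨by linarith [hb.2], by linarith [hb.1]⟩
    convert this using 1
    push_cast
    ring

section tiling

variable {T : Finset (Tile n)} {s t : Tile n} {p : ℂ} {m : Fin n}

theorem RightOfEdge.unique (hθ : IsAdmissible θ) (hT : IsRhombicTiling θ T) (hs : s ∈ T)
    (ht : t ∈ T) (h : RightOfEdge θ s p m) (h' : RightOfEdge θ t p m) : s = t := by
  by_contra hne
  obtain ⟨v, hv, hi⟩ := h.exists_interior hθ
  obtain ⟨v', hv', hi'⟩ := h'.exists_interior hθ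
  obtain ⟨a, ha, b, hb, a', ha', b', hb', e⟩ := exists_common_point hv hv'
  have h1 := hi a ha b hb
  rw [e] at h1
  exact (hT.disjoint_interior s hs t ht hne).le_bot ⟨h1, hi' a' ha' b' hb'⟩

theorem LeftOfEdge.unique (hθ : IsAdmissible θ) (hT : IsRhombicTiling θ T) (hs : s ∈ T)
    (ht : t ∈ T) (h : LeftOfEdge θ s p m) (h' : LeftOfEdge θ t p m) : s = t := by
  by_contra hne
  obtain ⟨v, hv, hi⟩ := h.exists_interior hθ
  obtain ⟨v', hv', hi'⟩ := h'.exists_interior hθ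
  obtain ⟨a, ha, b, hb, a', ha', b', hb', e⟩ := exists_common_point hv hv'
  -- Reflection in the midpoint of the edge turns the common point on the one side into one on the
  -- other.
  have h1 := hi (1 - a) ⟨by linarith [ha.2], by linarith [ha.1]⟩ b hb
  have h2 := hi' (1 - a') ⟨by linarith [ha'.2], by linarith [ha'.1]⟩ b' hb'
  have e' : ((1 - a : ℝ) : ℂ) * dir θ m + b * -v = ((1 - a' : ℝ) : ℂ) * dir θ m + b' * -v' := by
    push_cast
    linear_combination -e
  rw [e'] at h1
  exact (hT.disjoint_interior s hs t ht hne).le_bot ⟨h1, h2⟩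

theorem sidePerim_le (hθ : IsAdmissible θ) (hT : IsRhombicTiling θ T) :
    sidePerim θ T ≤ n - 1 := by
  classical
  unfold sidePerim
  rw [← Finset.card_range (n - 1)]
  refine Finset.card_le_card_of_injOn (fun t => (t.i : ℕ)) ?_ ?_
  · intro t ht
    have h := next_of_sidePerimeter hθ (Finset.mem_filter.1 ht).2
    have := t.j.2
    simp only [Finset.coe_range, Set.mem_Iio]
    omega
  · intro s hs t ht e
    have h1 := next_of_sidePerimeter hθ (Finset.mem_filter.1 hs).2
    have h2 := next_of_sidePerimeter hθ (Finset.mem_filter.1 ht).2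
    simp only at e
    exact tile_eq_of_labels hθ hT (Finset.mem_filter.1 hs).1 (Finset.mem_filter.1 ht).1
      (Fin.ext e) (Fin.ext (by omega))

/-- The position among the `n` pairs `(0,1), …, (n-2,n-1), (0,n-1)` of the labels of a tile. -/
def pairIndex (t : Tile n) : ℕ := if (t.j : ℕ) = t.i + 1 then t.i else n - 1

theorem pairIndex_spec (hθ : IsAdmissible θ) (h : t.IsPerimeter θ) :
    (t.j : ℕ) = t.i + 1 ∧ pairIndex t = t.i ∨
      (t.j : ℕ) ≠ t.i + 1 ∧ (t.i : ℕ) = 0 ∧ (t.j : ℕ) + 1 = n ∧ pairIndex t = n - 1 := by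
  unfold pairIndex
  by_cases hj : (t.j : ℕ) = t.i + 1
  · rw [if_pos hj]; exact Or.inl ⟨hj, rfl⟩
  · rw [if_neg hj]
    rcases perimeter_cases hθ h with h | h | h | h
    · exact absurd h.1 hj
    · exact absurd h.1 hj
    · exact Or.inr ⟨hj, h.1, h.2.1, rfl⟩
    · exact Or.inr ⟨hj, h.1, h.2.1, rfl⟩

theorem pairIndex_injOn (hθ : IsAdmissible θ) (hT : IsRhombicTiling θ T) (hs : s ∈ T)
    (ht : t ∈ T) (h : s.IsPerimeter θ) (h' : t.IsPerimeter θ) (e : pairIndex s = pairIndex t) :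
    s = t := by
  have h1 := pairIndex_spec hθ h
  have h2 := pairIndex_spec hθ h'
  have b1 := s.j.2
  have b2 := t.j.2
  exact tile_eq_of_labels hθ hT hs ht (Fin.ext (by omega)) (Fin.ext (by omega))

/-- If `n` is even, the corners `(0,1), …, (n-2,n-1), (0,n-1)` cannot all be filled. -/
theorem not_all_pairs (hθ : IsAdmissible θ) (hT : IsRhombicTiling θ T) (hn : 2 ≤ n)
    (heven : Even n) : ¬ ∀ k < n, ∃ t ∈ T, t.IsPerimeter θ ∧ pairIndex t = k := by
  intro hall
  obtain ⟨s, hs, hsp, hsk⟩ := hall (n - 1) (by omega)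
  have hspec := pairIndex_spec hθ hsp
  have hsj := s.j.2
  -- The index `n - 1` is not the smaller label of an adjacent pair, so `s` has the labels `0, n-1`
  -- and these are not adjacent. This excludes `n = 2`.
  have hs0 : (s.j : ℕ) ≠ s.i + 1 := by omega
  have hn4 : 4 ≤ n := by
    obtain ⟨r, hr⟩ := heven
    omega
  have hAB : ∀ k < n - 1, ∃ t ∈ T, (t.i : ℕ) = k ∧ (LeftCorner θ t ∨ RightCorner θ t) := by
    intro k hk
    obtain ⟨t, ht, htp, htk⟩ := hall k (by omega)
    have h1 := pairIndex_spec hθ htp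
    refine ⟨t, ht, by omega, ?_⟩
    rcases perimeter_cases hθ htp with h | h | h | h
    · exact Or.inl h
    · exact Or.inr h
    · exact absurd h.1 (by have := h.2.1; omega)
    · exact absurd h.1 (by have := h.2.1; omega)
  -- Both tiles would lie to the right of the leftside edge labeled `t.j`.
  have hA : ∀ t ∈ T, ∀ t' ∈ T, (t'.i : ℕ) = t.i + 1 → LeftCorner θ t → ¬ LeftCorner θ t' := by
    intro t ht t' ht' e h h'
    have e' : t'.i = t.j := Fin.ext (by rw [e, h.1])
    have := RightOfEdge.unique hθ hT ht ht' (p := start θ 1 t.j) (m := t.j)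
      (Or.inr ⟨rfl, h.2.2⟩) (Or.inl ⟨e', by rw [h'.2.1, e']⟩)
    rw [this] at e
    omega
  have hB : ∀ t ∈ T, ∀ t' ∈ T, (t'.i : ℕ) = t.i + 1 → RightCorner θ t → ¬ RightCorner θ t' := by
    intro t ht t' ht' e h h'
    have e' : t'.i = t.j := Fin.ext (by rw [e, h.1])
    have := LeftOfEdge.unique hθ hT ht ht' (p := start θ Fin.revPerm t.j) (m := t.j)
      (Or.inl ⟨rfl, h.2.1⟩) (Or.inr ⟨e', by rw [h'.2.2, e']⟩)
    rw [this] at e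
    omega
  have alt : ∀ l, 2 * l < n - 1 → ∀ t0 ∈ T, (t0.i : ℕ) = 0 →
      (LeftCorner θ t0 → ∃ t ∈ T, (t.i : ℕ) = 2 * l ∧ LeftCorner θ t) ∧
      (RightCorner θ t0 → ∃ t ∈ T, (t.i : ℕ) = 2 * l ∧ RightCorner θ t) := by
    intro l
    induction l with
    | zero =>
      intro _ t0 ht0 e
      exact ⟨fun h => ⟨t0, ht0, e, h⟩, fun h => ⟨t0, ht0, e, h⟩⟩
    | succ l ih =>
      intro hl t0 ht0 e
      obtain ⟨i1, i2⟩ := ih (by omega) t0 ht0 e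
      obtain ⟨u, hu, eu, hu'⟩ := hAB (2 * l + 1) (by omega)
      obtain ⟨v, hv, ev, hv'⟩ := hAB (2 * (l + 1)) hl
      constructor
      · intro h
        obtain ⟨t, ht, et, h'⟩ := i1 h
        have hu2 := hu'.resolve_left (hA t ht u hu (by omega) h')
        exact ⟨v, hv, ev, hv'.resolve_right (hB u hu v hv (by omega) hu2)⟩
      · intro h
        obtain ⟨t, ht, et, h'⟩ := i2 h
        have hu2 := hu'.resolve_right (hB t ht u hu (by omega) h')
        exact ⟨v, hv, ev, hv'.resolve_left (hA u hu v hv (by omega) hu2)⟩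
  obtain ⟨t0, ht0, e0, h0⟩ := hAB 0 (by omega)
  -- For even `n` the last adjacent pair has an even smaller label, so its tile is on the same side
  -- as that of the pair `0, 1`.
  have hlast : 2 * (n / 2 - 1) = n - 2 := by
    obtain ⟨r, hr⟩ := heven
    omega
  obtain ⟨alt1, alt2⟩ := alt (n / 2 - 1) (by omega) t0 ht0 e0
  have hcorner : TopCorner θ s ∨ BottomCorner θ s := by
    rcases perimeter_cases hθ hsp with h | h | h | h
    · exact absurd h.1 hs0
    · exact absurd h.1 hs0
    · exact Or.inl h
    · exact Or.inr h
  have ne_of : ∀ t, (t.j : ℕ) = t.i + 1 → s ≠ t := fun t h e => hs0 (by rw [e, h])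
  rcases h0 with h0 | h0
  · obtain ⟨t, ht, et, h⟩ := alt1 h0
    rcases hcorner with hc | hc
    · have e : t0.i = s.i := Fin.ext (by omega)
      exact ne_of t0 h0.1 (RightOfEdge.unique hθ hT hs ht0 (p := start θ 1 s.i) (m := s.i)
        (Or.inl ⟨rfl, hc.2.2.1⟩) (Or.inl ⟨e, by rw [h0.2.1, e]⟩))
    · have e : t.j = s.j := Fin.ext (by have := h.1; omega)
      exact ne_of t h.1 (RightOfEdge.unique hθ hT hs ht (p := start θ 1 s.j) (m := s.j)
        (Or.inr ⟨rfl, hc.2.2.1⟩) (Or.inr ⟨e, by rw [h.2.2, e]⟩))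
  · obtain ⟨t, ht, et, h⟩ := alt2 h0
    rcases hcorner with hc | hc
    · have e : t.j = s.j := Fin.ext (by have := h.1; omega)
      exact ne_of t h.1 (LeftOfEdge.unique hθ hT hs ht (p := start θ Fin.revPerm s.j) (m := s.j)
        (Or.inl ⟨rfl, hc.2.2.2⟩) (Or.inl ⟨e, by rw [h.2.1, e]⟩))
    · have e : t0.i = s.i := Fin.ext (by omega)
      exact ne_of t0 h0.1 (LeftOfEdge.unique hθ hT hs ht0 (p := start θ Fin.revPerm s.i) (m := s.i)
        (Or.inr ⟨rfl, hc.2.2.2⟩) (Or.inr ⟨e, by rw [h0.2.2, e]⟩))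

theorem perim_le (hθ : IsAdmissible θ) (hT : IsRhombicTiling θ T) (hn : 2 ≤ n) :
    perim θ T ≤ 2 * ((n - 1) / 2) + 1 := by
  classical
  unfold perim
  set P := T.filter fun t => t.IsPerimeter θ with hP
  have hmem : ∀ t ∈ P, t ∈ T ∧ t.IsPerimeter θ := fun t ht => Finset.mem_filter.1 ht
  have hinj : Set.InjOn pairIndex (P : Set (Tile n)) := fun s hs t ht e =>
    pairIndex_injOn hθ hT (hmem s hs).1 (hmem t ht).1 (hmem s hs).2 (hmem t ht).2 e
  have hsub : P.image pairIndex ⊆ Finset.range n := by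
    intro k hk
    obtain ⟨t, ht, rfl⟩ := Finset.mem_image.1 hk
    have := pairIndex_spec hθ (hmem t ht).2
    have := t.i.2
    rw [Finset.mem_range]
    omega
  have hcard : P.card ≤ n := by
    rw [← Finset.card_image_of_injOn hinj]
    exact (Finset.card_le_card hsub).trans (Finset.card_range n).le
  by_cases hodd : Odd n
  · obtain ⟨r, hr⟩ := hodd
    omega
  · have heven := Nat.not_odd_iff_even.1 hodd
    have hne : P.card ≠ n := by
      intro hc
      -- With `n` perimeter tiles the injection into `range n` would be onto, so all pairs would
      -- occur.
      have himg : P.image pairIndex = Finset.range n := by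
        refine Finset.eq_of_subset_of_card_le hsub ?_
        rw [Finset.card_range, Finset.card_image_of_injOn hinj, hc]
      refine not_all_pairs hθ hT hn heven fun k hk => ?_
      obtain ⟨t, ht, e⟩ := Finset.mem_image.1 (himg ▸ Finset.mem_range.2 hk)
      exact ⟨t, (hmem t ht).1, (hmem t ht).2, e⟩
    obtain ⟨r, hr⟩ := heven
    omega

end tiling

/-! ### Building tilings by flips -/

/-- The tiles `L` tile the part of the polygon to the left of the path `σ`, edge to edge. -/
structure Built (θ : Fin n → ℝ) (σ : Equiv.Perm (Fin n)) (L : Finset (Tile n)) : Prop where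
  left : ∀ t ∈ L, ∀ z ∈ t.carrier θ, LeftOf θ σ z
  cover : ∀ z ∈ polygon θ, (∃ t ∈ L, z ∈ t.carrier θ) ∨ RightOf θ σ z
  sub : ∀ t ∈ L, t.carrier θ ⊆ polygon θ
  disj : ∀ s ∈ L, ∀ t ∈ L, s ≠ t → Disjoint (interior (s.carrier θ)) (interior (t.carrier θ))
  edge_le : ∀ t ∈ L, ∀ k, cross (dir θ (t.edgeLabel k)) (t.edgeStart θ k) ≤
    cross (dir θ (t.edgeLabel k)) (start θ σ (t.edgeLabel k))
  edge_path : ∀ t ∈ L, ∀ k, cross (dir θ (t.edgeLabel k)) (t.edgeStart θ k) =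
    cross (dir θ (t.edgeLabel k)) (start θ σ (t.edgeLabel k)) →
    t.edgeStart θ k = start θ σ (t.edgeLabel k)
  edge_edge : ∀ s ∈ L, ∀ t ∈ L, ∀ k l, s.edgeLabel k = t.edgeLabel l →
    cross (dir θ (s.edgeLabel k)) (s.edgeStart θ k) =
      cross (dir θ (s.edgeLabel k)) (t.edgeStart θ l) → s.edgeStart θ k = t.edgeStart θ l

theorem Built.empty (hθ : IsAdmissible θ) : Built θ 1 ∅ where
  left := by simp
  cover := fun _ hz => Or.inr (hθ.rightOf_of_mem_polygon hz)
  sub := by simp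
  disj := by simp
  edge_le := by simp
  edge_path := by simp
  edge_edge := by simp

/-- The rhombus at two consecutive edges of the path `σ`. -/
noncomputable def flipTile (θ : Fin n → ℝ) (σ : Equiv.Perm (Fin n)) {i j : Fin n} (hij : i < j) :
    Tile n :=
  ⟨start θ σ i, i, j, hij⟩

section step

variable {σ : Equiv.Perm (Fin n)} {i j : Fin n}

/-- The determinant with `dir θ m` measures how far right the line of an edge labeled `m` is. This
offset never decreases under flips, and an unchanged offset means an unchanged edge; the
edge-to-edge conditions of `Built` follow by comparing offsets. -/
theorem cross_start_swap (hθ : IsAdmissible θ) (hij : i < j) (h : (σ j : ℕ) = σ i + 1)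
    (m : Fin n) :
    cross (dir θ m) (start θ σ m) < cross (dir θ m) (start θ (σ * Equiv.swap i j) m) ∨
      start θ σ m = start θ (σ * Equiv.swap i j) m := by
  have hD := hθ.cross_pos hij
  by_cases hmi : m = i
  · subst hmi
    left
    rw [start_swap_left θ h, cross_add_right]
    linarith
  by_cases hmj : m = j
  · subst hmj
    left
    rw [start_swap_right θ h, start_next θ h, cross_add_right, cross_swap (dir θ m) (dir θ i)]
    linarith
  exact Or.inr (start_swap_of_ne θ h hmi hmj).symm

theorem flipTile_edge (θ : Fin n → ℝ) (hij : i < j) (h : (σ j : ℕ) = σ i + 1) (k : Fin 4) :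
    (flipTile θ σ hij).edgeStart θ k = start θ σ ((flipTile θ σ hij).edgeLabel k) ∨
    (flipTile θ σ hij).edgeStart θ k =
      start θ (σ * Equiv.swap i j) ((flipTile θ σ hij).edgeLabel k) := by
  fin_cases k
  · exact Or.inl rfl
  · exact Or.inl (start_next θ h).symm
  · exact Or.inr (start_swap_left θ h).symm
  · exact Or.inr (start_swap_right θ h).symm

theorem flipTile_subset_polygon (hθ : IsAdmissible θ) (hij : i < j) (h : (σ j : ℕ) = σ i + 1) :
    (flipTile θ σ hij).carrier θ ⊆ polygon θ := by
  rintro z ⟨a, ha, b, hb, rfl⟩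
  refine add_mul_mem_of_convex (convex_polygon θ) (hθ.edge_mem_polygon σ i ha) ?_ hb
  have := hθ.edge_mem_polygon (σ * Equiv.swap i j) i ha
  rwa [start_swap_left θ h, add_right_comm] at this

/-- A common interior point is weakly right of the path, and a small horizontal move to the right
stays inside `s` but ends strictly right of the path. -/
theorem disjoint_interior_of_path (hθ : IsAdmissible θ) {s t : Tile n}
    (hs : ∀ z ∈ s.carrier θ, LeftOf θ σ z) (ht : ∀ z ∈ t.carrier θ, RightOf θ σ z)
    (htP : t.carrier θ ⊆ polygon θ) :
    Disjoint (interior (s.carrier θ)) (interior (t.carrier θ)) := by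
  rw [Set.disjoint_left]
  intro z hzs hzt
  have hzP := hθ.halfPlane_of_mem_polygon (htP (interior_subset hzt))
  obtain ⟨m, hm⟩ := exists_inStrip (θ := θ) t.i.pos σ hzP.1 hzP.2.1
  have hcont : Continuous fun ε : ℝ => z + (ε : ℂ) := by fun_prop
  have hopen : IsOpen ((fun ε : ℝ => z + (ε : ℂ)) ⁻¹' interior (s.carrier θ)) :=
    isOpen_interior.preimage hcont
  obtain ⟨ε, hε, hball⟩ := Metric.isOpen_iff.1 hopen 0 (by simpa using hzs)
  have hmem : z + ((ε / 2 : ℝ) : ℂ) ∈ s.carrier θ := interior_subset (hball (by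
    rw [Metric.mem_ball, Real.dist_eq, sub_zero, abs_of_pos (by linarith)]; linarith))
  have him : (z + ((ε / 2 : ℝ) : ℂ)).im = z.im := by simp
  have h1 := hs _ hmem m (by unfold InStrip; rwa [him])
  have h2 := ht z (interior_subset hzt) m hm
  have e : z + ((ε / 2 : ℝ) : ℂ) - start θ σ m
      = (z - start θ σ m) + ((z + ((ε / 2 : ℝ) : ℂ)) - z) := by ring
  rw [e, cross_add_right, cross_of_im_eq him] at h1
  have hre : (z + ((ε / 2 : ℝ) : ℂ)).re - z.re = ε / 2 := by simp
  rw [hre] at h1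
  have := hθ.im_dir_neg m
  nlinarith

-- The new rhombus is right of the old path and left of the new one, and it absorbs whatever the
-- path passes. Its edges all lie on one of these two paths, so an old edge collinear with one of
-- them has the largest offset allowed and lies on the old path itself.
open Classical in
theorem Built.step (hθ : IsAdmissible θ) {L : Finset (Tile n)} (hL : Built θ σ L) (hij : i < j)
    (h : (σ j : ℕ) = σ i + 1) :
    Built θ (σ * Equiv.swap i j) (insert (flipTile θ σ hij) L) := by
  set t := flipTile θ σ hij with ht
  have hright : ∀ z ∈ t.carrier θ, RightOf θ σ z := by
    rintro z ⟨a, ha, b, hb, hz⟩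
    exact rightOf_of_coord hθ hij h ha hb hz
  have hsub := flipTile_subset_polygon hθ hij h
  have hdis : ∀ s ∈ L, Disjoint (interior (s.carrier θ)) (interior (t.carrier θ)) := fun s hs =>
    disjoint_interior_of_path hθ (hL.left s hs) hright hsub
  have hlt := cross_start_swap hθ hij h
  have hle : ∀ m, cross (dir θ m) (start θ σ m) ≤
      cross (dir θ m) (start θ (σ * Equiv.swap i j) m) := fun m => by
    rcases hlt m with h | h
    · exact h.le
    · rw [h]
  have hpath : ∀ u ∈ L, ∀ k,
      cross (dir θ (u.edgeLabel k)) (start θ (σ * Equiv.swap i j) (u.edgeLabel k)) ≤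
        cross (dir θ (u.edgeLabel k)) (u.edgeStart θ k) →
      u.edgeStart θ k = start θ σ (u.edgeLabel k) ∧
        start θ σ (u.edgeLabel k) = start θ (σ * Equiv.swap i j) (u.edgeLabel k) := by
    intro u hu k hge
    have h1 := hL.edge_le u hu k
    exact ⟨hL.edge_path u hu k (le_antisymm h1 ((hle _).trans hge)),
      (hlt _).resolve_left (not_lt.2 (hge.trans h1))⟩
  have hold : ∀ u ∈ L, ∀ k l, u.edgeLabel k = t.edgeLabel l →
      cross (dir θ (u.edgeLabel k)) (u.edgeStart θ k) =
        cross (dir θ (u.edgeLabel k)) (t.edgeStart θ l) → u.edgeStart θ k = t.edgeStart θ l := by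
    intro u hu k l hlab hcr
    rcases flipTile_edge θ hij h l with e | e
    · rw [← ht, ← hlab] at e
      rw [e] at hcr ⊢
      exact hL.edge_path u hu k hcr
    · rw [← ht, ← hlab] at e
      rw [e] at hcr ⊢
      obtain ⟨h1, h2⟩ := hpath u hu k hcr.ge
      rw [h1, h2]
  refine ⟨?_, ?_, ?_, ?_, ?_, ?_, ?_⟩
  · intro u hu z hz
    rcases Finset.mem_insert.1 hu with rfl | hu
    · obtain ⟨a, ha, b, hb, hz⟩ := hz
      exact leftOf_swap_of_coord hθ hij h ha hb hz
    · exact (hL.left u hu z hz).swap hθ hij h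
  · intro z hz
    by_cases hr' : RightOf θ (σ * Equiv.swap i j) z
    · exact Or.inr hr'
    left
    rcases hL.cover z hz with ⟨u, hu, hzu⟩ | hr
    · exact ⟨u, Finset.mem_insert_of_mem hu, hzu⟩
    · have hc : z = start θ σ i + coordI θ i j (z - start θ σ i) * dir θ i
          + coordJ θ i j (z - start θ σ i) * dir θ j := by
        rw [add_assoc, ← eq_coord hθ hij]; ring
      obtain ⟨-, -, k3, k4⟩ := hr.coord_bounds_of_not_swap hθ hij h hc hr'
      exact ⟨t, Finset.mem_insert_self _ _, _, Set.Ioc_subset_Icc_self k3, _,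
        Set.Ico_subset_Icc_self k4, hc⟩
  · intro u hu
    rcases Finset.mem_insert.1 hu with rfl | hu
    · exact hsub
    · exact hL.sub u hu
  · intro u hu v hv huv
    rcases Finset.mem_insert.1 hu with rfl | hu' <;> rcases Finset.mem_insert.1 hv with rfl | hv'
    · exact absurd rfl huv
    · exact (hdis v hv').symm
    · exact hdis u hu'
    · exact hL.disj u hu' v hv' huv
  · intro u hu k
    rcases Finset.mem_insert.1 hu with rfl | hu
    · rcases flipTile_edge θ hij h k with e | e
      · rw [e]; exact hle _
      · rw [e]
    · exact (hL.edge_le u hu k).trans (hle _)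
  · intro u hu k hcr
    rcases Finset.mem_insert.1 hu with rfl | hu
    · rcases flipTile_edge θ hij h k with e | e
      · rw [e] at hcr ⊢
        exact (hlt _).resolve_left hcr.not_lt
      · exact e
    · obtain ⟨h1, h2⟩ := hpath u hu k hcr.ge
      rw [h1, h2]
  · intro u hu v hv k l hlab hcr
    rcases Finset.mem_insert.1 hu with rfl | hu' <;> rcases Finset.mem_insert.1 hv with rfl | hv'
    · rcases flipTile_edge θ hij h k with e | e <;> rcases flipTile_edge θ hij h l with e' | e' <;>
        rw [← ht, ← hlab] at e' <;> rw [e, e'] at hcr ⊢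
      · exact (hlt _).resolve_left hcr.not_lt
      · exact ((hlt _).resolve_left hcr.not_gt).symm
    · refine (hold v hv' l k hlab.symm ?_).symm
      rw [← hlab]
      exact hcr.symm
    · exact hold u hu' k l hlab hcr
    · exact hL.edge_edge u hu' v hv' k l hlab hcr

end step

theorem start_congr (θ : Fin n → ℝ) {σ τ : Equiv.Perm (Fin n)} {i j : Fin n}
    (h : ∀ x, σ x < σ i ↔ τ x < τ j) : start θ σ i = start θ τ j :=
  Finset.sum_congr (Finset.filter_congr fun x _ => h x) fun _ _ => rfl

/-- The center of the polygon is strictly to the left of the rightside boundary. -/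
theorem cross_center_neg (hθ : IsAdmissible θ) (hn : 2 ≤ n) (m : Fin n) :
    cross (dir θ m) (((1 / 2 : ℝ) : ℂ) * ∑ x, dir θ x - start θ Fin.revPerm m) < 0 := by
  have : ((1 / 2 : ℝ) : ℂ) * ∑ x, dir θ x - start θ Fin.revPerm m
      = ∑ x, (1 / 2 - if m < x then (1 : ℝ) else 0 : ℝ) * dir θ x := by
    simp only [start, Finset.sum_filter, Complex.ofReal_sub, sub_mul, Finset.sum_sub_distrib,
      Finset.mul_sum]
    congr 1
    simp [apply_ite, ite_mul]
  rw [this, cross_sum_right]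
  have hterm : ∀ x, x ≠ m →
      cross (dir θ m) ((1 / 2 - if m < x then (1 : ℝ) else 0 : ℝ) * dir θ x) < 0 := by
    intro x hx
    rw [cross_mul_right]
    rcases lt_or_gt_of_ne hx with h | h
    · have := hθ.cross_neg h
      rw [if_neg h.not_gt]
      linarith
    · have := hθ.cross_pos h
      rw [if_pos h]
      linarith
  have : Nontrivial (Fin n) := Fin.nontrivial_iff_two_le.2 hn
  obtain ⟨x, hx⟩ := exists_ne m
  refine Finset.sum_neg' (fun y _ => ?_) ⟨x, Finset.mem_univ _, hterm x hx⟩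
  by_cases hy : y = m
  · rw [hy, cross_mul_right, cross_self, mul_zero]
  · exact (hterm y hy).le

/-- The path is now the rightside boundary. Moving any point of the polygon slightly towards the
center puts it strictly left of that boundary, where `cover` provides a tile. The union of the tiles
is closed, so it contains the point itself. -/
theorem Built.isRhombicTiling (hθ : IsAdmissible θ) (hn : 2 ≤ n) {σ : Equiv.Perm (Fin n)}
    {L : Finset (Tile n)} (hL : Built θ σ L) (hσ : ∀ x y, σ x < σ y ↔ y < x) :
    IsRhombicTiling θ L where
  cover := by
    refine Set.Subset.antisymm (Set.iUnion₂_subset hL.sub) fun z hz => ?_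
    have hst : ∀ m, start θ σ m = start θ Fin.revPerm m := fun m =>
      start_congr θ fun x => by rw [hσ]; simp
    set c : ℂ := ((1 / 2 : ℝ) : ℂ) * ∑ x, dir θ x with hc
    have hcP : c ∈ polygon θ := by
      have h0 := hθ.sum_mem_polygon (by omega) ∅
      have h1 := hθ.sum_mem_polygon (by omega) Finset.univ
      have := add_mul_mem_of_convex (convex_polygon θ) h0 (u := ∑ x, dir θ x) (by simpa using h1)
        (a := 1 / 2) (by norm_num)
      simpa [hc] using this
    have hclosed : IsClosed (⋃ t ∈ L, t.carrier θ) :=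
      isClosed_biUnion_finset fun t _ => isClosed_carrier hθ t
    have hcont : Continuous fun ε : ℝ => z + (ε : ℂ) * (c - z) := by fun_prop
    have hIoo : Set.Ioo (0 : ℝ) 1 ⊆
        (fun ε : ℝ => z + (ε : ℂ) * (c - z)) ⁻¹' (⋃ t ∈ L, t.carrier θ) := by
      intro ε hε
      have hq : z + (ε : ℂ) * (c - z) ∈ polygon θ :=
        add_mul_mem_of_convex (convex_polygon θ) hz (by simpa using hcP)
          (Set.Ioo_subset_Icc_self hε)
      rcases hL.cover _ hq with ⟨t, ht, h⟩ | h
      · exact Set.mem_biUnion ht h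
      · exfalso
        have hqP := hθ.halfPlane_of_mem_polygon hq
        obtain ⟨m, hm⟩ := exists_inStrip (θ := θ) (by omega) σ hqP.1 hqP.2.1
        have h1 := h m hm
        have h2 := (hθ.halfPlane_of_mem_polygon hz).2.2.2 m
        have h3 := cross_center_neg hθ hn m
        rw [hst, show z + (ε : ℂ) * (c - z) - start θ Fin.revPerm m
          = ((1 - ε : ℝ) : ℂ) * (z - start θ Fin.revPerm m)
            + (ε : ℂ) * (c - start θ Fin.revPerm m) by push_cast; ring,
          cross_add_right, cross_mul_right, cross_mul_right] at h1
        have h4 := mul_neg_of_pos_of_neg hε.1 h3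
        have h5 := mul_nonpos_of_nonneg_of_nonpos (by linarith [hε.2] : 0 ≤ 1 - ε) h2
        linarith
    have := closure_minimal hIoo (hclosed.preimage hcont)
    rw [closure_Ioo zero_ne_one] at this
    simpa using this (Set.left_mem_Icc.2 zero_le_one)
  disjoint_interior := hL.disj
  edge_to_edge := by
    intro s hs t ht k l h
    rw [Tile.edge_eq, Tile.edge_eq] at h ⊢
    obtain ⟨h1, h2⟩ := label_eq_of_nontrivial_inter hθ h
    rw [hL.edge_edge s hs t ht k l h1 h2, h1]

/-! ### Sorting a path by a key -/

/-- A path all of whose consecutive labels increase with respect to `r` is sorted by `r`. -/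
theorem lt_iff_of_adjacent {σ : Equiv.Perm (Fin n)} {r : Fin n → ℤ}
    (h : ∀ i j, (σ j : ℕ) = σ i + 1 → r i < r j) (x y : Fin n) : σ x < σ y ↔ r x < r y := by
  have main : ∀ d : ℕ, ∀ x y, (σ y : ℕ) = σ x + (d + 1) → r x < r y := by
    intro d
    induction d with
    | zero => exact h
    | succ d ih =>
      intro x y e
      have hy := (σ y).2
      obtain ⟨w, hw⟩ := σ.surjective ⟨σ x + (d + 1), by omega⟩
      have hw' : (σ w : ℕ) = σ x + (d + 1) := by rw [hw]
      exact (ih x w hw').trans (h w y (by omega))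
  have mono : ∀ x y, σ x < σ y → r x < r y := fun x y hxy =>
    main ((σ y : ℕ) - σ x - 1) x y (by have := Fin.lt_def.1 hxy; omega)
  refine ⟨mono x y, fun hr => ?_⟩
  rcases lt_trichotomy (σ x) (σ y) with h1 | h1 | h1
  · exact h1
  · rw [σ.injective h1] at hr
    exact absurd hr (lt_irrefl _)
  · exact absurd (mono y x h1) hr.not_gt

open Classical in
/-- A partial tiling left of `σ` extends to one left of the path sorted by `r`, if `r` reverses all
pairs that `σ` reverses. Every newly reversed pair yields a tile, whose upper vertex is on an
intermediate path `τ`. -/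
theorem Built.extend (hθ : IsAdmissible θ) {r : Fin n → ℤ} (hr : Function.Injective r)
    {σ : Equiv.Perm (Fin n)} {L : Finset (Tile n)} (hL : Built θ σ L)
    (hσ : ∀ x y, x < y → σ y < σ x → r y < r x) :
    ∃ σ' L', L ⊆ L' ∧ Built θ σ' L' ∧ (∀ x y, σ' x < σ' y ↔ r x < r y) ∧
      ∀ i j, i < j → σ i < σ j → r j < r i → ∃ t ∈ L', t.i = i ∧ t.j = j ∧
        ∃ τ : Equiv.Perm (Fin n), t.top = start θ τ i ∧ (τ j : ℕ) = τ i + 1 ∧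
          (∀ x y, x < y → σ y < σ x → τ y < τ x) ∧ ∀ x y, x < y → τ y < τ x → r y < r x := by
  -- Bubble sort: the induction is on the number of pairs still to be reversed, and a flip at a
  -- consecutive descent of `r` removes exactly the pair `i, j`.
  induction hN : (Finset.univ.filter fun p : Fin n × Fin n =>
    p.1 < p.2 ∧ σ p.1 < σ p.2 ∧ r p.2 < r p.1).card using Nat.strong_induction_on
    generalizing σ L with
  | _ N ih =>
  by_cases hex : ∃ i j, (σ j : ℕ) = σ i + 1 ∧ r j < r i
  · obtain ⟨i, j, h, hrij⟩ := hex
    have hσij : σ i < σ j := by rw [Fin.lt_def]; omega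
    -- Were `j < i`, the path would already have reversed this pair, and by `hσ` the key would agree
    -- with that order.
    have hij : i < j := by
      rcases lt_trichotomy i j with h1 | h1 | h1
      · exact h1
      · rw [h1] at hrij; exact absurd hrij (lt_irrefl _)
      · exact absurd (hσ j i h1 hσij) hrij.not_gt
    have hσ'ij : (σ * Equiv.swap i j) j < (σ * Equiv.swap i j) i := by
      rw [Fin.lt_def, swap_next h]; omega
    have hiff : ∀ x y, x < y → ¬(x = i ∧ y = j) →
        ((σ * Equiv.swap i j) x < (σ * Equiv.swap i j) y ↔ σ x < σ y) ∧
        ((σ * Equiv.swap i j) y < (σ * Equiv.swap i j) x ↔ σ y < σ x) := by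
      intro x y hxy h1
      have h2 : ¬(x = j ∧ y = i) := by
        rintro ⟨rfl, rfl⟩
        exact lt_asymm hxy hij
      exact ⟨swap_lt_iff h h1 h2, swap_lt_iff h (fun e => h2 ⟨e.2, e.1⟩) fun e => h1 ⟨e.2, e.1⟩⟩
    have hcard : (Finset.univ.filter fun p : Fin n × Fin n => p.1 < p.2 ∧
        (σ * Equiv.swap i j) p.1 < (σ * Equiv.swap i j) p.2 ∧ r p.2 < r p.1).card < N := by
      rw [← hN]
      refine Finset.card_lt_card (Finset.ssubset_iff_of_subset ?_ |>.2 ⟨(i, j), ?_, ?_⟩)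
      · rintro ⟨x, y⟩ hp
        simp only [Finset.mem_filter, Finset.mem_univ, true_and] at hp ⊢
        refine ⟨hp.1, (hiff x y hp.1 ?_).1.1 hp.2.1, hp.2.2⟩
        rintro ⟨rfl, rfl⟩
        exact lt_asymm hp.2.1 hσ'ij
      · simp only [Finset.mem_filter, Finset.mem_univ, true_and]
        exact ⟨hij, hσij, hrij⟩
      · simp only [Finset.mem_filter, Finset.mem_univ, true_and]
        exact fun hp => lt_asymm hp.2.1 hσ'ij
    obtain ⟨σ', L', h1, h2, h3, h4⟩ := ih _ hcard (hL.step hθ hij h) (fun x y hxy hinv => by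
      by_cases he : x = i ∧ y = j
      · rw [he.1, he.2]; exact hrij
      · exact hσ x y hxy ((hiff x y hxy he).2.1 hinv)) rfl
    refine ⟨σ', L', (Finset.subset_insert _ _).trans h1, h2, h3, fun x y hxy hσxy hrxy => ?_⟩
    by_cases he : x = i ∧ y = j
    · obtain ⟨rfl, rfl⟩ := he
      exact ⟨_, h1 (Finset.mem_insert_self _ _), rfl, rfl, σ, rfl, h, fun _ _ _ => id, hσ⟩
    · obtain ⟨t, ht, ti, tj, τ, k1, k2, k3, k4⟩ := h4 x y hxy ((hiff x y hxy he).1.2 hσxy) hrxy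
      refine ⟨t, ht, ti, tj, τ, k1, k2, fun u v huv hinv => k3 u v huv ?_, k4⟩
      refine (hiff u v huv ?_).2.2 hinv
      rintro ⟨rfl, rfl⟩
      exact lt_asymm hinv hσij
  · push Not at hex
    have hiff := lt_iff_of_adjacent (σ := σ) (r := r) fun i j h => by
      refine lt_of_le_of_ne (hex i j h) fun e => ?_
      rw [hr e] at h
      omega
    refine ⟨σ, L, subset_rfl, hL, hiff, fun i j _ h h' => ?_⟩
    exact absurd ((hiff i j).1 h) h'.not_gt

/-! ### The extremal tiling -/

theorem LeftCorner.isPerimeter (hθ : IsAdmissible θ) {t : Tile n} (h : LeftCorner θ t) :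
    t.IsPerimeter θ :=
  ⟨0, (edge_mem_sides_iff hθ t _).2 (Or.inl h.2.1), (edge_mem_sides_iff hθ t _).2 (Or.inl h.2.2)⟩

theorem RightCorner.isPerimeter (hθ : IsAdmissible θ) {t : Tile n} (h : RightCorner θ t) :
    t.IsPerimeter θ :=
  ⟨2, (edge_mem_sides_iff hθ t _).2 (Or.inr h.2.2), (edge_mem_sides_iff hθ t _).2 (Or.inr h.2.1)⟩

theorem TopCorner.isPerimeter (hθ : IsAdmissible θ) {t : Tile n} (h : TopCorner θ t) :
    t.IsPerimeter θ :=
  ⟨3, (edge_mem_sides_iff hθ t _).2 (Or.inr h.2.2.2),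
    (edge_mem_sides_iff hθ t _).2 (Or.inl h.2.2.1)⟩

/-- Sorting by this key exchanges `2k+1` and `2k+2`. -/
def leftKey (x : ℕ) : ℤ := if x % 2 = 1 then x + 1 else x - 1

/-- For odd `n`, the key `leftKey` with `n - 1` moved to the front. -/
def topKey (n x : ℕ) : ℤ := if n % 2 = 1 ∧ x + 1 = n then -2 else leftKey x

/-- Sorting by this key reverses the order, except that `2k` stays before `2k+1`. -/
def rightKey (x : ℕ) : ℤ := if x % 2 = 0 then -(x + 1) else -(x - 1)

/-- There is a tiling with the left corners `(2k+1,2k+2)`, the right corners `(2k,2k+1)` and, if `n`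
is odd, the top corner. -/
theorem exists_tiling (hθ : IsAdmissible θ) (hn : 2 ≤ n) :
    ∃ T : Finset (Tile n), IsRhombicTiling θ T ∧
      (∀ i j : Fin n, (j : ℕ) = i + 1 → ∃ t ∈ T, t.i = i ∧ t.j = j ∧ t.IsPerimeter θ) ∧
      (n % 2 = 1 → ∃ t ∈ T, (t.i : ℕ) = 0 ∧ (t.j : ℕ) + 1 = n ∧ t.IsPerimeter θ) := by
  have inj : ∀ f : ℕ → ℤ, (∀ x y : ℕ, x < n → y < n → f x = f y → x = y) →
      Function.Injective fun x : Fin n => f x := fun f hf x y e =>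
    Fin.ext (hf x y x.2 y.2 e)
  obtain ⟨σ₁, L₁, -, b₁, o₁, p₁⟩ := (Built.empty hθ).extend hθ (r := fun x => leftKey x)
    (inj _ fun x y _ _ e => by unfold leftKey at e; split_ifs at e <;> omega)
    (fun x y h h' => absurd h' h.not_gt)
  obtain ⟨σ₂, L₂, s₂, b₂, o₂, p₂⟩ := b₁.extend hθ (r := fun x => topKey n x)
    (inj _ fun x y _ _ e => by unfold topKey leftKey at e; split_ifs at e <;> omega)
    (fun x y h h' => by
      have h' := (o₁ y x).1 h'
      rw [Fin.lt_def] at h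
      unfold leftKey at h'
      unfold topKey leftKey
      split_ifs at h' ⊢ <;> omega)
  obtain ⟨σ₃, L₃, s₃, b₃, o₃, -⟩ := b₂.extend hθ (r := fun x => rightKey x)
    (inj _ fun x y _ _ e => by unfold rightKey at e; split_ifs at e <;> omega)
    (fun x y h h' => by
      have h' := (o₂ y x).1 h'
      rw [Fin.lt_def] at h
      unfold topKey leftKey at h'
      unfold rightKey
      split_ifs at h' ⊢ <;> omega)
  obtain ⟨σ₄, L₄, s₄, b₄, o₄, p₄⟩ := b₃.extend hθ (r := fun x => -((x : ℕ) : ℤ))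
    (inj (fun x => -(x : ℤ)) fun x y _ _ e => by omega)
    (fun x y h h' => by
      rw [Fin.lt_def] at h
      omega)
  refine ⟨L₄, b₄.isRhombicTiling hθ hn fun x y => ?_, ?_, ?_⟩
  · rw [o₄, Fin.lt_def]; omega
  · intro i j hj
    have hij : i < j := by rw [Fin.lt_def]; omega
    rcases Nat.mod_two_eq_zero_or_one i with hi | hi
    -- For even `i` the pair is flipped in the last stage, when only pairs `2k, 2k+1` can still be
    -- unreversed. The labels before `i` on `τ` are thus those above `j`, which is a vertex of the
    -- rightside boundary.
    · obtain ⟨t, ht, rfl, rfl, τ, k1, k2, k3, k4⟩ := p₄ i j hij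
        ((o₃ i j).2 (by unfold rightKey; split_ifs <;> omega)) (by omega)
      refine ⟨t, ht, rfl, rfl, RightCorner.isPerimeter hθ ?_⟩
      have htop : t.top = start θ Fin.revPerm t.j := by
        rw [k1]
        refine start_congr θ fun x => ?_
        rw [Fin.revPerm_apply, Fin.revPerm_apply, Fin.rev_lt_rev]
        constructor
        · intro hx
          by_contra hxj
          rw [Fin.lt_def] at hx hxj
          have hxi : (x : ℕ) ≠ t.i := fun e => by rw [Fin.ext e] at hx; omega
          have hxj' : (x : ℕ) ≠ t.j := fun e => by rw [Fin.ext e] at hx; omega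
          have := Fin.lt_def.1 (k3 x t.i (by rw [Fin.lt_def]; omega)
            ((o₃ t.i x).2 (by unfold rightKey; split_ifs <;> omega)))
          omega
        · intro hx
          rw [Fin.lt_def] at hx
          exact k3 t.i x (by rw [Fin.lt_def]; omega)
            ((o₃ x t.i).2 (by unfold rightKey; split_ifs <;> omega))
      refine ⟨hj, htop, ?_⟩
      rw [htop, start_next θ (σ := Fin.revPerm) (i := t.j) (j := t.i)]
      simp only [Fin.revPerm_apply, Fin.val_rev]
      have := t.j.2
      omega
    -- For odd `i` the pair is flipped in the first stage, when only pairs `2k+1, 2k+2` can be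
    -- reversed. The labels before `i` on `τ` are thus those below `i`.
    · obtain ⟨t, ht, rfl, rfl, τ, k1, k2, -, k4⟩ := p₁ i j hij hij
        (by unfold leftKey; split_ifs <;> omega)
      refine ⟨t, s₄ (s₃ (s₂ ht)), rfl, rfl, LeftCorner.isPerimeter hθ ?_⟩
      have htop : t.top = start θ 1 t.i := by
        rw [k1]
        refine start_congr θ fun x => ?_
        rw [Equiv.Perm.one_apply, Equiv.Perm.one_apply]
        constructor
        · intro hx
          by_contra hxi
          have hne : x ≠ t.i := fun e => by rw [e] at hx; exact lt_irrefl _ hx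
          have h1 : t.i < x := lt_of_le_of_ne (not_lt.1 hxi) hne.symm
          have h2 := k4 t.i x h1 hx
          have h3 : (x : ℕ) = t.j := by
            rw [Fin.lt_def] at h1
            unfold leftKey at h2
            split_ifs at h2 <;> omega
          rw [Fin.ext h3, Fin.lt_def] at hx
          omega
        · intro hx
          by_contra hτ
          have hne : τ x ≠ τ t.i := fun e => by
            rw [τ.injective e] at hx; exact lt_irrefl _ hx
          have h2 := k4 x t.i hx (lt_of_le_of_ne (not_lt.1 hτ) hne.symm)
          rw [Fin.lt_def] at hx
          unfold leftKey at h2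
          split_ifs at h2 <;> omega
      exact ⟨hj, htop, by rw [htop, start_next θ (σ := 1) (i := t.i) (j := t.j) hj]⟩
  · intro hodd
    -- In the second stage only `n-1` can overtake `0`, and on `τ` it comes directly after `0`.
    -- Nothing precedes `0`, so the rhombus hangs from the topmost vertex.
    obtain ⟨t, ht, hi, hj, τ, k1, k2, -, k4⟩ := p₂ ⟨0, by omega⟩ ⟨n - 1, by omega⟩
      (Fin.lt_def.2 (show 0 < n - 1 by omega))
      ((o₁ ⟨0, by omega⟩ ⟨n - 1, by omega⟩).2 (by
        change leftKey 0 < leftKey (n - 1)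
        rw [show leftKey 0 = -1 from rfl, leftKey]
        split_ifs <;> omega))
      (by
        change topKey n (n - 1) < topKey n 0
        unfold topKey leftKey
        split_ifs <;> omega)
    have hi' : (t.i : ℕ) = 0 := by rw [hi]
    have hj' : (t.j : ℕ) + 1 = n := by rw [hj]; simp only; omega
    refine ⟨t, s₄ (s₃ ht), hi', hj', TopCorner.isPerimeter hθ ⟨hi', hj', ?_, ?_⟩⟩
    all_goals
      rw [k1]
      refine start_congr θ fun x => ?_
      refine iff_of_false (fun hx => ?_) ?_
    · have hx0 : (x : ℕ) ≠ 0 := fun e => by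
        rw [show x = ⟨0, by omega⟩ from Fin.ext e] at hx
        exact lt_irrefl _ hx
      have h2 := k4 ⟨0, by omega⟩ x (Fin.lt_def.2 (Nat.pos_of_ne_zero hx0)) hx
      have h3 : (x : ℕ) = n - 1 := by
        unfold topKey leftKey at h2
        simp only at h2
        split_ifs at h2 <;> omega
      rw [show x = ⟨n - 1, by omega⟩ from Fin.ext h3, Fin.lt_def] at hx
      omega
    · rw [Equiv.Perm.one_apply, Equiv.Perm.one_apply, Fin.lt_def]
      omega
    · have hx0 : (x : ℕ) ≠ 0 := fun e => by
        rw [show x = ⟨0, by omega⟩ from Fin.ext e] at hx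
        exact lt_irrefl _ hx
      have h2 := k4 ⟨0, by omega⟩ x (Fin.lt_def.2 (Nat.pos_of_ne_zero hx0)) hx
      have h3 : (x : ℕ) = n - 1 := by
        unfold topKey leftKey at h2
        simp only at h2
        split_ifs at h2 <;> omega
      rw [show x = ⟨n - 1, by omega⟩ from Fin.ext h3, Fin.lt_def] at hx
      omega
    · rw [Fin.revPerm_apply, Fin.revPerm_apply, Fin.rev_lt_rev, Fin.lt_def]
      have := x.2
      omega

theorem exists_tiling_perim (hθ : IsAdmissible θ) (hn : 2 ≤ n) :
    ∃ T : Finset (Tile n), IsRhombicTiling θ T ∧ perim θ T = 2 * ((n - 1) / 2) + 1 := by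
  classical
  obtain ⟨T, hT, hside, htop⟩ := exists_tiling hθ hn
  refine ⟨T, hT, le_antisymm (perim_le hθ hT hn) ?_⟩
  unfold perim
  have hsub : Finset.range (2 * ((n - 1) / 2) + 1) ⊆
      (T.filter fun t => t.IsPerimeter θ).image pairIndex := by
    intro k hk
    rw [Finset.mem_range] at hk
    rw [Finset.mem_image]
    by_cases hk' : k + 1 < n
    · obtain ⟨t, ht, ti, tj, hp⟩ := hside ⟨k, by omega⟩ ⟨k + 1, hk'⟩ rfl
      refine ⟨t, Finset.mem_filter.2 ⟨ht, hp⟩, ?_⟩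
      rw [pairIndex, ti, tj, if_pos rfl]
    -- Here `k = n - 1`, which is below `2 * ((n - 1) / 2) + 1` only for odd `n`.
    · obtain ⟨t, ht, ti, tj, hp⟩ := htop (by omega)
      refine ⟨t, Finset.mem_filter.2 ⟨ht, hp⟩, ?_⟩
      rw [pairIndex, if_neg (by omega)]
      omega
  have := (Finset.card_le_card hsub).trans Finset.card_image_le
  rwa [Finset.card_range] at this

end Elnitsky

theorem mainTheorem2 (n : ℕ) (hn : 2 ≤ n) (θ : Fin n → ℝ) (hθ : Elnitsky.IsAdmissible θ) :
    IsGreatest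
        {m : ℕ | ∃ T : Finset (Elnitsky.Tile n),
          Elnitsky.IsRhombicTiling θ T ∧ Elnitsky.perim θ T = m}
        (2 * ((n - 1) / 2) + 1) ∧
      (2 * ((n - 1) / 2) + 1 = if Odd n then n else n - 1) ∧
      ∀ T : Finset (Elnitsky.Tile n), Elnitsky.IsRhombicTiling θ T →
        Elnitsky.sidePerim θ T ≤ n - 1 := by
  refine ⟨⟨Elnitsky.exists_tiling_perim hθ hn, ?_⟩, ?_, fun T hT => Elnitsky.sidePerim_le hθ hT⟩
  · rintro m ⟨T, hT, rfl⟩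
    exact Elnitsky.perim_le hθ hT hn
  · split_ifs with h
    · obtain ⟨r, hr⟩ := h
      omega
    · obtain ⟨r, hr⟩ := Nat.not_odd_iff_even.1 h
      omega
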